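/- **Model.** A single resource of capacity $b>0$ serves $m$ request classes with Poisson arrival rates $\lambda_i>0$, exponential service rates $\mu_i>0$, request sizes $b_i>0$ and reward rates $r_i\ge 0$; $\rho_i=\lambda_i/\mu_i$. For $B\ge 0$ let $\mathrm{LP}(B)$ be: maximize $\sum_i r_i\rho_i\alpha_i$ subject to $\sum_i b_i\rho_i\alpha_i\le B$, $0\le\alpha_i\le1$. Its dual is: minimize $uB+\sum_i v_i$ subject to $v_i+b_i\rho_iu\ge r_i\rho_i$, $v\ge0$, $u\ge0$. Let $(u^*,v^*)$ be an optimal solution of the dual of $\mathrm{LP}(b)$ and let $\varepsilon_0\in[0,\infty]$ be the supremum of the $\varepsilon\ge0$ for which $(u^*,v^*)$ is optimal for the dual of $\mathrm{LP}(b/(1+4\varepsilon))$. **Policy.** Let $0<\varepsilon<\min\{\varepsilon_0,\frac14\}$, let $\alpha^\varepsilon$ be an optimal solution of $\mathrm{LP}(b/(1+4\varepsilon))$, and put $\beta=\frac2\varepsilon\log\frac2\varepsilon+4$, $c_i^0=(1+4\varepsilon)\alpha_i^\varepsilon b_i\rho_i$, $c_i^1=(1+4\varepsilon)(1-\alpha_i^\varepsilon)b_i\rho_i$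 and $\Psi_i(x_i,y_i)=\exp(\beta b_ix_i/c_i^0)+\exp(\beta b_iy_i/c_i^1)$. In state $(x,y)\in\mathbb Z_+^{2m}$ the penalty policy admits an arriving class $i$ request (to system 0, $x_i\to x_i+1$) iff $\partial\Psi_i/\partial x_i\le\partial\Psi_i/\partial y_i$ and $\sum_jb_jx_j+b_i\le b$; otherwise it sends the request to a fictitious infinite-capacity system 1 ($y_i\to y_i+1$), where it is served at rate $\mu_i$. (A partial derivative with $c_i^0=0$ or $c_i^1=0$ is read as $+\infty$.) **Scaling.** The $n$th system has capacity $b$, arrival rates $n\lambda_i$, service rates $\mu_i$, request sizes $b_i/n$ and reward rates $r_i/n$, and uses the same $\alpha^\varepsilon$ and $\beta$. It starts with $x(0^-)=0$ and with $y_i(0^-)$ equal to $(1-\alpha_i^\varepsilon)n\rho_i$, rounded up or down to an integer. All systems are driven by the same independent rate-one Poisson processes $A_i^x,A_i^y,D_i^x,D_i^y$ ($i=1,\dots,m$): with $\nu_{x,i}(s)=n\lambda_i$ if the policy admits class $i$ in state $s$ and $0$ otherwise, and $\nu_{y,i}=n\lambda_i-\nu_{x,i}$, the state $s(t)=(x(t),y(t))$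 satisfies $$x_i(t)=A_i^x\Big(\int_0^t\nu_{x,i}(s(\tau))\,d\tau\Big)-D_i^x\Big(\int_0^t\mu_ix_i(\tau)\,d\tau\Big),$$ $$y_i(t)=y_i(0^-)+A_i^y\Big(\int_0^t\nu_{y,i}(s(\tau))\,d\tau\Big)-D_i^y\Big(\int_0^t\mu_iy_i(\tau)\,d\tau\Big).$$ Let $\bar R^{(n)}(t)=\sum_i\frac{r_i}{n}x_i(t)$ be the reward rate of the $n$th system. **Theorem 3.** For every $t\ge0$ the limit $\bar R^{(\infty)}(t)=\lim_{n\to\infty}\bar R^{(n)}(t)$ exists almost surely and is nonrandom (it depends on $t$, $\varepsilon$ and $\alpha^\varepsilon$). Moreover there is a constant $C$, depending only on the data $m,b,\lambda,\mu,(b_i),r$ and not on $\varepsilon$, $t$, $\alpha^\varepsilon$ or $(u^*,v^*)$, such that the bound $$\bar R^{(\infty)}(t)\ \ge\ \sum_{i=1}^m r_i\rho_i\alpha_i^*\,(1-e^{-\mu_it})-C\varepsilon\qquad\text{for all }t\ge0$$ holds in the following sense: for every $\alpha^\varepsilon$ there is an optimal solution $\alpha^*$ of $\mathrm{LP}(b)$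 for which it holds, and for every optimal solution $\alpha^*$ of $\mathrm{LP}(b)$ there is an optimal solution $\alpha^\varepsilon$ of $\mathrm{LP}(b/(1+4\varepsilon))$ for which it holds. (In particular it holds for every $\alpha^\varepsilon$ when $\alpha^*$ is unique.) -/

import Mathlib

open MeasureTheory ProbabilityTheory Filter Topology
open scoped NNReal

noncomputable section

namespace LossNetwork

/-- Data of a single-resource loss network with `m` request classes: capacity `b`, arrival rates
`lam i`, service rates `mu i`, request sizes `size i` and reward rates `rew i`. -/
structure Model (m : ℕ) where
  b : ℝ
  lam : Fin m → ℝ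
  mu : Fin m → ℝ
  size : Fin m → ℝ
  rew : Fin m → ℝ

namespace Model

variable {m : ℕ}

/-- The sign conditions on the data of a loss network. -/
structure Valid (M : Model m) : Prop where
  b_pos : 0 < M.b
  lam_pos : ∀ i, 0 < M.lam i
  mu_pos : ∀ i, 0 < M.mu i
  size_pos : ∀ i, 0 < M.size i
  rew_nonneg : ∀ i, 0 ≤ M.rew i

/-- The load `ρ_i = λ_i / μ_i`. -/
def rho (M : Model m) (i : Fin m) : ℝ := M.lam i / M.mu i

/-- The `n`-th system of the Halfin-Whitt scaling: same capacity and service rates, arrival rates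
`n λ_i`, request sizes `b_i / n`, reward rates `r_i / n`. -/
def scale (M : Model m) (n : ℕ) : Model m where
  b := M.b
  lam := fun i => n * M.lam i
  mu := M.mu
  size := fun i => M.size i / n
  rew := fun i => M.rew i / n

/-! ### The linear program with capacity `B`, and its dual -/

/-- Feasibility for: maximize `∑ r_i ρ_i α_i` subject to `∑ b_i ρ_i α_i ≤ B`, `0 ≤ α_i ≤ 1`. -/
def PrimalFeasible (M : Model m) (B : ℝ) (α : Fin m → ℝ) : Prop :=
  ∑ i, M.size i * M.rho i * α i ≤ B ∧ ∀ i, 0 ≤ α i ∧ α i ≤ 1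

/-- The objective `∑ r_i ρ_i α_i`. -/
def primalValue (M : Model m) (α : Fin m → ℝ) : ℝ := ∑ i, M.rew i * M.rho i * α i

/-- `α` is an optimal solution of the linear program with capacity `B`. -/
def PrimalOptimal (M : Model m) (B : ℝ) (α : Fin m → ℝ) : Prop :=
  M.PrimalFeasible B α ∧ ∀ α', M.PrimalFeasible B α' → M.primalValue α' ≤ M.primalValue α

/-- Feasibility for the dual: minimize `u B + ∑ v_i` subject to `v_i + b_i ρ_i u ≥ r_i ρ_i`,
`v ≥ 0`, `u ≥ 0`. -/
def DualFeasible (M : Model m) (u : ℝ) (v : Fin m → ℝ) : Prop :=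
  (∀ i, M.rew i * M.rho i ≤ v i + M.size i * M.rho i * u) ∧ (∀ i, 0 ≤ v i) ∧ 0 ≤ u

/-- `(u, v)` is an optimal solution of the dual linear program with capacity `B`. -/
def DualOptimal (M : Model m) (B : ℝ) (u : ℝ) (v : Fin m → ℝ) : Prop :=
  M.DualFeasible u v ∧
    ∀ u' v', M.DualFeasible u' v' → u * B + ∑ i, v i ≤ u' * B + ∑ i, v' i

/-- The capacity `b / (1 + 4 ε)` of the `ε`-perturbed linear program. -/
def perturbedCap (M : Model m) (ε : ℝ) : ℝ := M.b / (1 + 4 * ε)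

/-- `ε₀`: the supremum of the `ε ≥ 0` for which `(u, v)` is optimal for the dual of the
`ε`-perturbed linear program (`⊤` if there is no largest one). -/
def epsZero (M : Model m) (u : ℝ) (v : Fin m → ℝ) : EReal :=
  sSup ((fun ε : ℝ => (ε : EReal)) '' {ε | 0 ≤ ε ∧ M.DualOptimal (M.perturbedCap ε) u v})

/-! ### The exponential penalty policy -/

/-- The target capacities `c_i⁰ = (1 + 4 ε) α_i b_i ρ_i` of the original system (system 0). -/
def target0 (M : Model m) (ε : ℝ) (α : Fin m → ℝ) (i : Fin m) : ℝ :=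
  (1 + 4 * ε) * α i * M.size i * M.rho i

/-- The target capacities `c_i¹ = (1 + 4 ε) (1 - α_i) b_i ρ_i` of the fictitious system
(system 1). -/
def target1 (M : Model m) (ε : ℝ) (α : Fin m → ℝ) (i : Fin m) : ℝ :=
  (1 + 4 * ε) * (1 - α i) * M.size i * M.rho i

/-- The parameter `β = (2 / ε) log (2 / ε) + 4`. -/
def _root_.LossNetwork.penaltyBeta (ε : ℝ) : ℝ := 2 / ε * Real.log (2 / ε) + 4

/-- One of the two terms `exp (β b_i z / c)` of the penalty `Ψ_i`. -/
def _root_.LossNetwork.penaltyTerm (β bi c z : ℝ) : ℝ := Real.exp (β * (bi * z / c))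

/-- The partial derivative of `Ψ_i` in the direction of the term with target capacity `c`, at `z`.
A target capacity `c = 0` makes the penalty infinitely steep. -/
def _root_.LossNetwork.penaltySlope (β bi c z : ℝ) : EReal :=
  if c = 0 then ⊤ else ((deriv (fun w => penaltyTerm β bi c w) z : ℝ) : EReal)

/-- In state `(x, y)` the penalty policy admits an arriving class `i` request to system 0:
`∂Ψ_i/∂x_i ≤ ∂Ψ_i/∂y_i`, and there is enough capacity. -/
def Admits (M : Model m) (ε : ℝ) (α : Fin m → ℝ) (x y : Fin m → ℕ) (i : Fin m) : Prop :=
  penaltySlope (penaltyBeta ε) (M.size i) (M.target0 ε α i) (x i) ≤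
      penaltySlope (penaltyBeta ε) (M.size i) (M.target1 ε α i) (y i) ∧
    ∑ j, M.size j * (x j : ℝ) + M.size i ≤ M.b

open Classical in
/-- Arrival rate of class `i` to system 0 in state `(x, y)`. -/
def rateX (M : Model m) (ε : ℝ) (α : Fin m → ℝ) (x y : Fin m → ℕ) (i : Fin m) : ℝ :=
  if M.Admits ε α x y i then M.lam i else 0

open Classical in
/-- Arrival rate of class `i` to system 1 in state `(x, y)`: the rejected requests go there. -/
def rateY (M : Model m) (ε : ℝ) (α : Fin m → ℝ) (x y : Fin m → ℕ) (i : Fin m) : ℝ :=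
  if M.Admits ε α x y i then 0 else M.lam i

/-- Instantaneous reward rate `∑ r_i x_i`. -/
def rewardRate (M : Model m) (x : Fin m → ℕ) : ℝ := ∑ i, M.rew i * (x i : ℝ)

end Model

/-! ### Poisson clocks and the state process -/

/-- A Poisson process of rate one on `[0, ∞)`, with a.s. nondecreasing right-continuous paths. -/
structure IsUnitPoisson {Ω : Type*} [MeasurableSpace Ω] (P : Measure Ω)
    (N : ℝ≥0 → Ω → ℕ) : Prop where
  measurable : ∀ t, Measurable (N t)
  zero : ∀ᵐ ω ∂P, N 0 ω = 0
  paths : ∀ᵐ ω ∂P, Monotone (fun t => N t ω) ∧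
    ∀ t, ContinuousWithinAt (fun s => N s ω) (Set.Ici t) t
  increments : ∀ s t : ℝ≥0, s ≤ t → HasLaw (fun ω => N t ω - N s ω) (poissonMeasure (t - s)) P
  indep : HasIndepIncrements N P

/-- The four kinds of clocks attached to each class: arrivals to and departures from
system 0 (`x`) and system 1 (`y`). -/
inductive Clock
  | arrX | arrY | depX | depY

/-- `N` is a family of independent Poisson processes of rate one, four for each class. -/
structure IsClockFamily {m : ℕ} {Ω : Type*} [MeasurableSpace Ω] (P : Measure Ω)
    (N : Clock × Fin m → ℝ≥0 → Ω → ℕ) : Prop where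
  poisson : ∀ k, IsUnitPoisson P (N k)
  indep : iIndepFun (fun k ω t => N k t ω) P

/-- `(x, y)` is the trajectory on `[0, ∞)` of the state of the augmented network under the penalty
policy, driven by the realization `N` of the clocks and started with system 0 empty and `y0 i`
requests of class `i` in system 1. -/
structure IsPenaltyPath {m : ℕ} (M : Model m) (ε : ℝ) (α : Fin m → ℝ) (y0 : Fin m → ℕ)
    (N : Clock × Fin m → ℝ≥0 → ℕ) (x y : ℝ → Fin m → ℕ) : Prop where
  rightCont_x : ∀ i, ∀ t, 0 ≤ t → ContinuousWithinAt (fun s => x s i) (Set.Ici t) t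
  rightCont_y : ∀ i, ∀ t, 0 ≤ t → ContinuousWithinAt (fun s => y s i) (Set.Ici t) t
  eq_x : ∀ i, ∀ t, 0 ≤ t → (x t i : ℤ) =
    N (Clock.arrX, i) (∫ s in (0 : ℝ)..t, M.rateX ε α (x s) (y s) i).toNNReal -
      N (Clock.depX, i) (∫ s in (0 : ℝ)..t, M.mu i * (x s i : ℝ)).toNNReal
  eq_y : ∀ i, ∀ t, 0 ≤ t → (y t i : ℤ) = y0 i +
    N (Clock.arrY, i) (∫ s in (0 : ℝ)..t, M.rateY ε α (x s) (y s) i).toNNReal -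
      N (Clock.depY, i) (∫ s in (0 : ℝ)..t, M.mu i * (y s i : ℝ)).toNNReal

end LossNetwork

end

/-! Taking logarithms of the two slopes turns the penalty comparison into a linear threshold. For 0
< α_i < 1 and apart from the capacity check, class i is admitted in the nth system iff x_i ≤ α_i
(x_i + y_i) + n κ_i (`penaltySlope_le_iff`). The offset κ_i, called `thresholdShift`, has size at
most ρ_i ε because (1 + 4ε)/β ≤ ε.

The total x_i + y_i is an infinite-server queue whatever the policy does. Its fluid limit is
therefore explicit, Z = ρ - αρ e^{-μt}, and the threshold becomes a deterministic curve Θ = αZ + κ.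
System 0 fills as fast as it can, along Φ = ρ(1 - e^{-μt}), and is then held at Θ. This gives the
limit max(0, min(Φ, Θ)), called `fluidOccupancy`.

The upper half of this limit uses only rejections above the threshold, so it holds with or without
capacity blocking. By `sum_size_mul_fluidOccupancy_lt` its load is at most (1 + (1 + 4ε)/β) b/(1 +
4ε) < b. Hence in large systems nothing is blocked on [0, T], the classes decouple, and the lower
half follows.

Randomness enters only through the strong law, which gives |N(t) - t| ≤ δt + C for all clocks at
once. On that event each class satisfies deterministic balance equations up to an error η
(`ApproxFlow`), and one-sided comparisons by `le_two_mul_of_barrier` give bounds linear in η, with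
constants independent of T.

For the reward, α² ≤ α gives a fluid occupancy of at least αρ(1 - e^{-μt}) - ρε. The program is a
fractional knapsack, and an optimal solution for one capacity has an optimal solution for the other
within b - b/(1 + 4ε) ≤ 4bε of it, in weight. This works in both directions, whence the two forms of
the bound. -/

noncomputable section

namespace LossNetwork

/-! ### Stability of the fractional knapsack problem in the capacity -/

section Knapsack

variable {ι : Type*} [Fintype ι]

/-- The points of the box `[l, h]` whose weight lies between `B₁` and `B₂`. -/
def knapsackSet (w l h : ι → ℝ) (B₁ B₂ : ℝ) : Set (ι → ℝ) :=
  {α | (∀ i, l i ≤ α i ∧ α i ≤ h i) ∧ B₁ ≤ ∑ i, w i * α i ∧ ∑ i, w i * α i ≤ B₂}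

lemma isCompact_knapsackSet (w l h : ι → ℝ) (B₁ B₂ : ℝ) :
    IsCompact (knapsackSet w l h B₁ B₂) := by
  have hc : Continuous fun α : ι → ℝ => ∑ i, w i * α i := by fun_prop
  have hbox : IsCompact (Set.Icc l h) := isCompact_Icc
  have : knapsackSet w l h B₁ B₂ =
      Set.Icc l h ∩ {α | B₁ ≤ ∑ i, w i * α i ∧ ∑ i, w i * α i ≤ B₂} := by
    ext α
    simp only [knapsackSet, Set.mem_ofPred_eq, Set.mem_inter_iff, Set.mem_Icc, Pi.le_def,
      forall_and]
  rw [this]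
  exact hbox.inter_right
    ((isClosed_le continuous_const hc).inter (isClosed_le hc continuous_const))

lemma exists_maximizer_knapsackSet (c : ι → ℝ) {w l h : ι → ℝ} {B₁ B₂ : ℝ}
    (hne : (knapsackSet w l h B₁ B₂).Nonempty) :
    ∃ α ∈ knapsackSet w l h B₁ B₂, ∀ γ ∈ knapsackSet w l h B₁ B₂,
      ∑ i, c i * γ i ≤ ∑ i, c i * α i := by
  have hc : Continuous fun α : ι → ℝ => ∑ i, c i * α i := by fun_prop
  obtain ⟨α, hα, hmax⟩ := (isCompact_knapsackSet w l h B₁ B₂).exists_isMaxOn hne hc.continuousOn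
  exact ⟨α, hα, fun γ hγ => hmax hγ⟩

/-- The exchange and tightness conditions are sufficient for optimality. -/
lemma knapsack_optimal_of_exchange {c w : ι → ℝ} {B : ℝ} (hw : ∀ i, 0 < w i) (hc : ∀ i, 0 ≤ c i)
    {α γ : ι → ℝ} (hex : ∀ i j, α i < 1 → 0 < α j → c i * w j ≤ c j * w i)
    (htight : ∀ i, α i < 1 → 0 < c i → ∑ k, w k * α k = B)
    (hγ : ∀ i, 0 ≤ γ i ∧ γ i ≤ 1) (hγB : ∑ k, w k * γ k ≤ B) :
    ∑ i, c i * γ i ≤ ∑ i, c i * α i := by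
  by_cases hI : (Finset.univ.filter fun i => α i < 1).Nonempty
  · obtain ⟨i₀, hi₀, hmax⟩ := Finset.exists_max_image _ (fun i => c i / w i) hI
    have hi₀ : α i₀ < 1 := by simpa using hi₀
    set u := c i₀ / w i₀ with hu
    have hu0 : 0 ≤ u := div_nonneg (hc _) (hw _).le
    have hlow : ∀ j, 0 < α j → u * w j ≤ c j := fun j hj => by
      rw [hu, div_mul_eq_mul_div, div_le_iff₀ (hw i₀)]
      exact hex i₀ j hi₀ hj
    have hterm : ∀ j, c j * (γ j - α j) ≤ u * (w j * (γ j - α j)) := fun j => by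
      by_cases hj : α j < 1
      · have hup : c j ≤ u * w j := by
          have : c j / w j ≤ u := hmax j (by simpa using hj)
          rwa [div_le_iff₀ (hw j)] at this
        rcases le_total (α j) (γ j) with h | h
        · nlinarith [mul_nonneg (sub_nonneg.2 hup) (sub_nonneg.2 h)]
        · rcases eq_or_lt_of_le h with h | h
          · simp [h]
          · have := hlow j ((hγ j).1.trans_lt h)
            nlinarith [mul_nonneg (sub_nonneg.2 this) (sub_nonneg.2 h.le)]
      · push Not at hj
        have h1 := hlow j (by linarith)
        have h2 : γ j ≤ α j := (hγ j).2.trans hj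
        nlinarith [mul_nonneg (sub_nonneg.2 h1) (sub_nonneg.2 h2)]
    have hsum : ∑ j, c j * (γ j - α j) ≤ u * (∑ j, w j * γ j - ∑ j, w j * α j) := by
      rw [← Finset.sum_sub_distrib, Finset.mul_sum]
      refine Finset.sum_le_sum fun j _ => ?_
      rw [← mul_sub]
      exact hterm j
    have hnonpos : u * (∑ j, w j * γ j - ∑ j, w j * α j) ≤ 0 := by
      rcases eq_or_lt_of_le (hc i₀) with h | h
      · rw [hu, ← h]; simp
      · rw [htight i₀ hi₀ h]
        exact mul_nonpos_of_nonneg_of_nonpos hu0 (by linarith)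
    simp only [mul_sub, Finset.sum_sub_distrib] at hsum
    simp only [mul_sub] at hnonpos
    linarith
  · refine Finset.sum_le_sum fun j _ => mul_le_mul_of_nonneg_left ?_ (hc j)
    have : ¬ α j < 1 := fun h => hI ⟨j, by simpa using h⟩
    linarith [(hγ j).2]

variable [DecidableEq ι]

lemma sum_mul_shift (f α : ι → ℝ) (i j : ι) (a a' : ℝ) :
    ∑ k, f k * (α k + (if k = i then a else 0) - (if k = j then a' else 0)) =
      ∑ k, f k * α k + f i * a - f j * a' := by
  simp [mul_add, mul_sub, Finset.sum_add_distrib, Finset.sum_sub_distrib]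

/-- At a maximizer, no weight can be moved profitably from `j` to `i`. -/
lemma knapsack_exchange {c w l h : ι → ℝ} {B₁ B₂ : ℝ} (hw : ∀ i, 0 < w i) {α : ι → ℝ}
    (hα : α ∈ knapsackSet w l h B₁ B₂)
    (hmax : ∀ γ ∈ knapsackSet w l h B₁ B₂, ∑ i, c i * γ i ≤ ∑ i, c i * α i)
    {i j : ι} (hi : α i < h i) (hj : l j < α j) : c i * w j ≤ c j * w i := by
  by_contra! hlt
  have hij : i ≠ j := by rintro rfl; exact lt_irrefl _ hlt
  have hwi := hw i
  have hwj := hw j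
  -- Adding w_j δ to item i and removing w_i δ from item j leaves the total weight unchanged; δ is
  -- the largest step that stays in the box.
  set δ := min ((h i - α i) / w j) ((α j - l j) / w i) with hδ
  have hδ0 : 0 < δ := lt_min (div_pos (by linarith) hwj) (div_pos (by linarith) hwi)
  have h1 : w j * δ ≤ h i - α i := by
    have : δ ≤ (h i - α i) / w j := min_le_left _ _
    rw [le_div_iff₀ hwj] at this; linarith
  have h2 : w i * δ ≤ α j - l j := by
    have : δ ≤ (α j - l j) / w i := min_le_right _ _
    rw [le_div_iff₀ hwi] at this; linarith
  have p1 : 0 < w j * δ := mul_pos hwj hδ0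
  have p2 : 0 < w i * δ := mul_pos hwi hδ0
  have hsum := sum_mul_shift w α i j (w j * δ) (w i * δ)
  have hval := sum_mul_shift c α i j (w j * δ) (w i * δ)
  have key := hmax (fun k => α k + (if k = i then w j * δ else 0) -
    (if k = j then w i * δ else 0)) ?_
  · rw [hval] at key
    nlinarith
  · refine ⟨fun k => ?_, ?_, ?_⟩
    · have := hα.1 k
      by_cases hki : k = i
      · subst hki
        simp only [if_true, if_neg hij]
        constructor <;> linarith
      · by_cases hkj : k = j
        · subst hkj
          simp only [if_true, if_neg hki]
          constructor <;> linarith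
        · simpa [hki, hkj] using this
    · rw [hsum]; linarith [hα.2.1, mul_left_comm (w i) (w j) δ]
    · rw [hsum]; linarith [hα.2.2, mul_left_comm (w i) (w j) δ]

/-- A maximizer uses up the capacity if a profitable item is not exhausted. -/
lemma knapsack_tight {c w l h : ι → ℝ} {B₁ B₂ : ℝ} (hw : ∀ i, 0 < w i) {α : ι → ℝ}
    (hα : α ∈ knapsackSet w l h B₁ B₂)
    (hmax : ∀ γ ∈ knapsackSet w l h B₁ B₂, ∑ i, c i * γ i ≤ ∑ i, c i * α i)
    {i : ι} (hi : α i < h i) (hci : 0 < c i) : ∑ k, w k * α k = B₂ := by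
  by_contra hne
  have hlt := lt_of_le_of_ne hα.2.2 hne
  have hwi := hw i
  set δ := min (h i - α i) ((B₂ - ∑ k, w k * α k) / w i) with hδ
  have hδ0 : 0 < δ := lt_min (by linarith) (div_pos (by linarith) hwi)
  have h1 : δ ≤ h i - α i := min_le_left _ _
  have h2 : δ * w i ≤ B₂ - ∑ k, w k * α k := by
    have : δ ≤ (B₂ - ∑ k, w k * α k) / w i := min_le_right _ _
    rwa [le_div_iff₀ hwi] at this
  have p : 0 < δ * w i := mul_pos hδ0 hwi
  have hsum := sum_mul_shift w α i i δ 0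
  have hval := sum_mul_shift c α i i δ 0
  have key := hmax (fun k => α k + (if k = i then δ else 0) - (if k = i then 0 else 0)) ?_
  · rw [hval] at key
    nlinarith
  · refine ⟨fun k => ?_, ?_, ?_⟩
    · have := hα.1 k
      by_cases hki : k = i
      · subst hki
        simp only [if_true]
        constructor <;> linarith
      · simpa [hki] using this
    · rw [hsum]; linarith [hα.2.1]
    · rw [hsum]; linarith [hα.2.2]

end Knapsack

/-! ### Optimal solutions of the linear program under a change of capacity -/

namespace Model

variable {m : ℕ}

/-- The load `b_i ρ_i` that class `i` puts on the resource. -/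
def weight (M : Model m) (i : Fin m) : ℝ := M.size i * M.rho i

lemma Valid.rho_pos {M : Model m} (hM : M.Valid) (i : Fin m) : 0 < M.rho i :=
  div_pos (hM.lam_pos i) (hM.mu_pos i)

lemma Valid.weight_pos {M : Model m} (hM : M.Valid) (i : Fin m) : 0 < M.weight i :=
  mul_pos (hM.size_pos i) (hM.rho_pos i)

lemma Valid.value_nonneg {M : Model m} (hM : M.Valid) (i : Fin m) : 0 ≤ M.rew i * M.rho i :=
  mul_nonneg (hM.rew_nonneg i) (hM.rho_pos i).le

lemma Valid.primalFeasible_iff {M : Model m} (hM : M.Valid) {B : ℝ} {α : Fin m → ℝ} :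
    M.PrimalFeasible B α ↔ α ∈ knapsackSet M.weight 0 1 0 B := by
  constructor
  · rintro ⟨h1, h2⟩
    exact ⟨h2, Finset.sum_nonneg fun i _ => mul_nonneg (hM.weight_pos i).le (h2 i).1, h1⟩
  · rintro ⟨h1, -, h2⟩
    exact ⟨h2, h1⟩

/-- In a one-constraint knapsack, local moves already detect optimality: exchanging two items, or
filling spare capacity with a valuable one. These conditions can be checked coordinatewise for a
solution that is optimal only within a smaller box. -/
lemma Valid.primalOptimal_iff {M : Model m} (hM : M.Valid) {B : ℝ} {α : Fin m → ℝ} :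
    M.PrimalOptimal B α ↔ M.PrimalFeasible B α ∧
      (∀ i j, α i < 1 → 0 < α j →
        M.rew i * M.rho i * M.weight j ≤ M.rew j * M.rho j * M.weight i) ∧
      ∀ i, α i < 1 → 0 < M.rew i * M.rho i → ∑ k, M.weight k * α k = B := by
  constructor
  · rintro ⟨hf, hmax⟩
    have hα := hM.primalFeasible_iff.1 hf
    have hm : ∀ γ ∈ knapsackSet M.weight 0 1 0 B,
        ∑ i, M.rew i * M.rho i * γ i ≤ ∑ i, M.rew i * M.rho i * α i :=
      fun γ hγ => hmax γ (hM.primalFeasible_iff.2 hγ)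
    exact ⟨hf, fun i j hi hj => knapsack_exchange hM.weight_pos hα hm hi hj,
      fun i hi hc => knapsack_tight (c := fun i => M.rew i * M.rho i) hM.weight_pos hα hm hi hc⟩
  · rintro ⟨hf, hex, ht⟩
    exact ⟨hf, fun γ hγ => knapsack_optimal_of_exchange hM.weight_pos hM.value_nonneg hex ht
      hγ.2 hγ.1⟩

/-- Optimal solutions move at most proportionally to the capacity, when it increases. -/
lemma Valid.exists_primalOptimal_of_le {M : Model m} (hM : M.Valid) {B B' : ℝ} (hB : B ≤ B')
    {α : Fin m → ℝ} (hα : M.PrimalOptimal B α) :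
    ∃ α', M.PrimalOptimal B' α' ∧ ∀ i, M.weight i * |α' i - α i| ≤ B' - B := by
  obtain ⟨hf, hex, ht⟩ := hM.primalOptimal_iff.1 hα
  have hf' := hM.primalFeasible_iff.1 hf
  -- Coordinates are only allowed to grow from `α`, and total weight by at most B' - B, so closeness
  -- is built in. Coordinates that stay put inherit their conditions from `α`; the others get them
  -- from maximality in the box.
  have hne : (knapsackSet M.weight α 1 0 (∑ i, M.weight i * α i + (B' - B))).Nonempty :=
    ⟨α, fun i => ⟨le_rfl, (hf.2 i).2⟩, hf'.2.1, by linarith⟩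
  obtain ⟨α', hα', hmax⟩ := exists_maximizer_knapsackSet (fun i => M.rew i * M.rho i) hne
  refine ⟨α', hM.primalOptimal_iff.2 ⟨⟨?_, fun i => ⟨(hf.2 i).1.trans (hα'.1 i).1, (hα'.1 i).2⟩⟩,
    fun i j hi hj => ?_, fun i hi hc => ?_⟩, fun i => ?_⟩
  · have h1 := hα'.2.2
    have h2 := hf'.2.2
    change ∑ i, M.weight i * α' i ≤ B'
    linarith
  · rcases eq_or_lt_of_le (hα'.1 j).1 with h | h
    · exact hex i j ((hα'.1 i).1.trans_lt hi) (h ▸ hj)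
    · exact knapsack_exchange hM.weight_pos hα' hmax hi h
  · have h1 := knapsack_tight hM.weight_pos hα' hmax hi hc
    have h2 := ht i ((hα'.1 i).1.trans_lt hi) hc
    linarith
  · rw [abs_of_nonneg (sub_nonneg.2 (hα'.1 i).1)]
    have h1 : M.weight i * (α' i - α i) ≤ ∑ k, M.weight k * (α' k - α k) :=
      Finset.single_le_sum (f := fun k => M.weight k * (α' k - α k))
        (fun k _ => mul_nonneg (hM.weight_pos k).le (sub_nonneg.2 (hα'.1 k).1))
        (Finset.mem_univ i)
    have h2 := hα'.2.2
    simp only [mul_sub, Finset.sum_sub_distrib] at h1 ⊢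
    linarith

/-- Optimal solutions move at most proportionally to the capacity, when it decreases. -/
lemma Valid.exists_primalOptimal_of_ge {M : Model m} (hM : M.Valid) {B B' : ℝ} (hB0 : 0 ≤ B)
    (hB : B ≤ B') (hB' : 0 < B') {α' : Fin m → ℝ} (hα' : M.PrimalOptimal B' α') :
    ∃ α, M.PrimalOptimal B α ∧ ∀ i, M.weight i * |α' i - α i| ≤ B' - B := by
  obtain ⟨hf, hex, ht⟩ := hM.primalOptimal_iff.1 hα'
  have hf' := hM.primalFeasible_iff.1 hf
  -- Coordinates may only shrink, and the lower bound on the weight limits the total loss to B' - B.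
  -- Scaling `α'` by B / B' meets all the constraints.
  have hne : (knapsackSet M.weight 0 α' (∑ i, M.weight i * α' i - (B' - B)) B).Nonempty := by
    have hq1 : B / B' ≤ 1 := (div_le_one hB').2 hB
    have hq0 : 0 ≤ B / B' := div_nonneg hB0 hB'.le
    have hsum : ∑ i, M.weight i * (B / B' * α' i) = B / B' * ∑ i, M.weight i * α' i := by
      rw [Finset.mul_sum]
      exact Finset.sum_congr rfl fun i _ => by ring
    have hqB : B / B' * B' = B := div_mul_cancel₀ _ hB'.ne'
    have h2 := hf'.2.2
    refine ⟨fun i => B / B' * α' i, fun i => ⟨mul_nonneg hq0 (hf.2 i).1,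
      mul_le_of_le_one_left (hf.2 i).1 hq1⟩, ?_, ?_⟩
    · rw [hsum]; nlinarith
    · rw [hsum]; nlinarith
  obtain ⟨α, hα, hmax⟩ := exists_maximizer_knapsackSet (fun i => M.rew i * M.rho i) hne
  refine ⟨α, hM.primalOptimal_iff.2 ⟨⟨hα.2.2, fun i => ⟨(hα.1 i).1, (hα.1 i).2.trans (hf.2 i).2⟩⟩,
    fun i j hi hj => ?_, fun i hi hc => ?_⟩, fun i => ?_⟩
  · rcases eq_or_lt_of_le (hα.1 i).2 with h | h
    · exact hex i j (h ▸ hi) (hj.trans_le (hα.1 j).2)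
    · exact knapsack_exchange hM.weight_pos hα hmax h hj
  -- If i was not lowered and capacity is left over, then some j was lowered. Tightness in the box
  -- forces j to be worthless, but `α'` used j while leaving the valuable i unfilled, against
  -- exchange.
  · rcases eq_or_lt_of_le (hα.1 i).2 with h | h
    · by_contra hne'
      have hlt := lt_of_le_of_ne hα.2.2 hne'
      have htα' := ht i (h ▸ hi) hc
      obtain ⟨j, hj⟩ : ∃ j, α j < α' j := by
        by_contra! hall
        have : ∑ k, M.weight k * α' k ≤ ∑ k, M.weight k * α k :=
          Finset.sum_le_sum fun k _ => mul_le_mul_of_nonneg_left (hall k) (hM.weight_pos k).le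
        linarith
      have hcj : ¬ 0 < M.rew j * M.rho j := fun hcj =>
        hne' (knapsack_tight (c := fun i => M.rew i * M.rho i) hM.weight_pos hα hmax hj hcj)
      have h1 := hex i j (h ▸ hi) ((hα.1 j).1.trans_lt hj)
      have h2 : M.rew j * M.rho j = 0 := le_antisymm (not_lt.1 hcj) (hM.value_nonneg j)
      rw [h2, zero_mul] at h1
      exact absurd (mul_pos hc (hM.weight_pos j)) (not_lt.2 h1)
    · exact knapsack_tight hM.weight_pos hα hmax h hc
  · rw [abs_of_nonneg (sub_nonneg.2 (hα.1 i).2)]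
    have h1 : M.weight i * (α' i - α i) ≤ ∑ k, M.weight k * (α' k - α k) :=
      Finset.single_le_sum (f := fun k => M.weight k * (α' k - α k))
        (fun k _ => mul_nonneg (hM.weight_pos k).le (sub_nonneg.2 (hα.1 k).2))
        (Finset.mem_univ i)
    have h2 := hα.2.1
    simp only [mul_sub, Finset.sum_sub_distrib] at h1 ⊢
    linarith

end Model

/-! ### Fluid limits of a single class -/

section Fluid

/-- A function whose growth is at most `c` plus the integral of a rate `g`, nonpositive wherever
the function is positive, never exceeds `2 c`. -/
lemma le_two_mul_of_barrier {f g : ℝ → ℝ} {T c L : ℝ} (hf0 : f 0 ≤ 0)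
    (hg : IntervalIntegrable g volume 0 T) (hgL : ∀ r, 0 ≤ r → r ≤ T → g r ≤ L)
    (hgneg : ∀ r, 0 ≤ r → r ≤ T → 0 < f r → g r ≤ 0)
    (hinc : ∀ s t, 0 ≤ s → s ≤ t → t ≤ T → f t - f s ≤ (∫ r in s..t, g r) + c)
    {t : ℝ} (ht0 : 0 ≤ t) (htT : t ≤ T) : f t ≤ 2 * c := by
  have hsub : ∀ s r, 0 ≤ s → s ≤ r → r ≤ T → IntervalIntegrable g volume s r :=
    fun s r hs hsr hr => hg.mono_set (by
      rw [Set.uIcc_of_le hsr, Set.uIcc_of_le (hs.trans (hsr.trans hr))]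
      exact Set.Icc_subset_Icc hs hr)
  have hc : 0 ≤ c := by
    have := hinc 0 0 le_rfl le_rfl (ht0.trans htT)
    simpa using this
  by_contra! hlt
  set S : Set ℝ := {r | 0 ≤ r ∧ r ≤ t ∧ f r ≤ 0}
  have h0S : (0 : ℝ) ∈ S := ⟨le_rfl, ht0, hf0⟩
  have hbdd : BddAbove S := ⟨t, fun r hr => hr.2.1⟩
  set s := sSup S
  have hs0 : 0 ≤ s := le_csSup hbdd h0S
  have hst : s ≤ t := csSup_le ⟨0, h0S⟩ fun r hr => hr.2.1
  have hpos : ∀ r, s < r → r ≤ t → 0 < f r := fun r hr hrt => by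
    by_contra! h
    exact absurd (le_csSup hbdd ⟨hs0.trans hr.le, hrt, h⟩) (not_le.2 hr)
  have h1 : f t - f s ≤ c := by
    have h := hinc s t hs0 hst htT
    have : ∫ r in s..t, g r ≤ ∫ r in s..t, (0 : ℝ) := by
      refine intervalIntegral.integral_mono_on_of_le_Ioo hst (hsub s t hs0 hst htT) (by simp) ?_
      intro r hr
      exact hgneg r (hs0.trans hr.1.le) (hr.2.le.trans htT) (hpos r hr.1 hr.2.le)
    simp at this
    linarith
  -- `f` may jump, so it need not be nonpositive at the supremum s itself. Starting from points of S
  -- just below s costs one more c, hence the factor 2.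
  have h2 : f s ≤ c := by
    refine le_of_forall_pos_le_add fun e he => ?_
    set e' := e / (|L| + 1)
    have hL : 0 < |L| + 1 := by positivity
    have he' : 0 < e' := div_pos he hL
    obtain ⟨r, hr, hrs⟩ := exists_lt_of_lt_csSup ⟨0, h0S⟩ (sub_lt_self s he')
    have hrs' : r ≤ s := le_csSup hbdd hr
    have h := hinc r s hr.1 hrs' (hst.trans htT)
    have hint : ∫ x in r..s, g x ≤ ∫ x in r..s, L :=
      intervalIntegral.integral_mono_on hrs' (hsub r s hr.1 hrs' (hst.trans htT)) (by simp)
        fun x hx => hgL x (hr.1.trans hx.1) (hx.2.trans (hst.trans htT))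
    rw [intervalIntegral.integral_const, smul_eq_mul] at hint
    have h3 : (s - r) * L ≤ e' * (|L| + 1) :=
      (mul_le_mul_of_nonneg_left (le_abs_self L) (by linarith)).trans
        (mul_le_mul (by linarith) (by linarith) (abs_nonneg _) he'.le)
    have h4 : e' * (|L| + 1) = e := div_mul_cancel₀ _ hL.ne'
    have := hr.2.2
    linarith
  linarith

/-- The solution `K - a e^{-μ t}` of the relaxation equation `F' = μ (K - F)`. -/
def relax (mu K a t : ℝ) : ℝ := K - a * Real.exp (-(mu * t))

lemma continuous_relax (mu K a : ℝ) : Continuous (relax mu K a) := by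
  unfold relax; fun_prop

/-- Puts the explicit fluid curves in the same integral form as the flow balance equations, so that
differences can be fed to the barrier lemma. -/
lemma relax_sub_eq_integral (mu K a s t : ℝ) :
    relax mu K a t - relax mu K a s = ∫ r in s..t, mu * (K - relax mu K a r) := by
  have hderiv : ∀ r ∈ Set.uIcc s t,
      HasDerivAt (relax mu K a) (mu * (K - relax mu K a r)) r := fun r _ => by
    have h1 : HasDerivAt (fun r => -(mu * r)) (-(mu * 1)) r :=
      ((hasDerivAt_id r).const_mul mu).neg
    have h2 := (h1.exp.const_mul a).const_sub K
    convert! h2 using 1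
    simp only [relax]
    ring
  have hcont := continuous_relax mu K a
  rw [intervalIntegral.integral_eq_sub_of_hasDerivAt hderiv
    (by apply Continuous.intervalIntegrable; fun_prop)]

/-- On `[0, T]`, the class is offered work at rate `lam`; the rate `ν` of it goes to system 0. The
occupancies `X`, `Y` of the two systems solve their flow balance equations up to an error `η`. -/
structure ApproxFlow (lam mu rho al T η : ℝ) (ν X Y : ℝ → ℝ) : Prop where
  int_nu : IntervalIntegrable ν volume 0 T
  int_X : IntervalIntegrable X volume 0 T
  int_Y : IntervalIntegrable Y volume 0 T
  nu_mem : ∀ t, 0 ≤ ν t ∧ ν t ≤ lam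
  X_nonneg : ∀ t, 0 ≤ X t
  Y_nonneg : ∀ t, 0 ≤ Y t
  bounded : ∃ L, ∀ t, 0 ≤ t → t ≤ T → X t ≤ L ∧ Y t ≤ L
  X_zero : X 0 = 0
  Y_zero : |Y 0 - (1 - al) * rho| ≤ η
  eq_X : ∀ t, 0 ≤ t → t ≤ T → |X t - ∫ r in (0 : ℝ)..t, (ν r - mu * X r)| ≤ η
  eq_Y : ∀ t, 0 ≤ t → t ≤ T → |Y t - Y 0 - ∫ r in (0 : ℝ)..t, (lam - ν r - mu * Y r)| ≤ η

namespace ApproxFlow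

variable {lam mu rho al T η : ℝ} {ν X Y : ℝ → ℝ}

lemma intervalIntegrable_of_le {g : ℝ → ℝ} (hg : IntervalIntegrable g volume 0 T) {s t : ℝ}
    (hs : 0 ≤ s) (hst : s ≤ t) (ht : t ≤ T) : IntervalIntegrable g volume s t :=
  hg.mono_set (by
    rw [Set.uIcc_of_le hst, Set.uIcc_of_le (hs.trans (hst.trans ht))]
    exact Set.Icc_subset_Icc hs ht)

lemma increment_of_abs_le {F g : ℝ → ℝ} {a : ℝ} (hg : IntervalIntegrable g volume 0 T)
    (h : ∀ t, 0 ≤ t → t ≤ T → |F t - a - ∫ r in (0 : ℝ)..t, g r| ≤ η) {s t : ℝ}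
    (hs : 0 ≤ s) (hst : s ≤ t) (ht : t ≤ T) :
    |F t - F s - ∫ r in s..t, g r| ≤ 2 * η := by
  have h1 := abs_le.1 (h t (hs.trans hst) ht)
  have h2 := abs_le.1 (h s hs (hst.trans ht))
  have h3 := intervalIntegral.integral_add_adjacent_intervals
    (intervalIntegrable_of_le hg le_rfl hs (hst.trans ht)) (intervalIntegrable_of_le hg hs hst ht)
  rw [abs_le]
  constructor <;> linarith

variable (h : ApproxFlow lam mu rho al T η ν X Y)
include h

lemma int_balance_X : IntervalIntegrable (fun r => ν r - mu * X r) volume 0 T :=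
  h.int_nu.sub (h.int_X.const_mul mu)

lemma int_balance_Y : IntervalIntegrable (fun r => lam - ν r - mu * Y r) volume 0 T :=
  (intervalIntegrable_const.sub h.int_nu).sub (h.int_Y.const_mul mu)

lemma increment_X {s t : ℝ} (hs : 0 ≤ s) (hst : s ≤ t) (ht : t ≤ T) :
    |X t - X s - ∫ r in s..t, (ν r - mu * X r)| ≤ 2 * η :=
  increment_of_abs_le (a := 0) h.int_balance_X (by simpa using h.eq_X) hs hst ht

lemma increment_Y {s t : ℝ} (hs : 0 ≤ s) (hst : s ≤ t) (ht : t ≤ T) :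
    |Y t - Y s - ∫ r in s..t, (lam - ν r - mu * Y r)| ≤ 2 * η :=
  increment_of_abs_le h.int_balance_Y h.eq_Y hs hst ht

lemma eta_nonneg : 0 ≤ η := (abs_nonneg _).trans h.Y_zero

/-- The total occupancy, which does not depend on the policy, is close to its fluid limit. -/
lemma abs_total_sub_le (hmu : 0 < mu) (hrho : 0 ≤ rho) (hlam : lam = mu * rho) (hal0 : 0 ≤ al)
    {t : ℝ} (ht0 : 0 ≤ t) (htT : t ≤ T) :
    |X t + Y t - relax mu rho (al * rho) t| ≤ 9 * η := by
  have hη := h.eta_nonneg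
  have hY0 := abs_le.1 h.Y_zero
  obtain ⟨L, hL⟩ := h.bounded
  set Z := relax mu rho (al * rho) with hZ
  have hZ0 : Z 0 = (1 - al) * rho := by simp [hZ, relax]; ring
  have hZle : ∀ r, 0 ≤ r → (1 - al) * rho ≤ Z r ∧ Z r ≤ rho := fun r hr => by
    have h1 : Real.exp (-(mu * r)) ≤ 1 := Real.exp_le_one_iff.2 (by nlinarith)
    have h2 : 0 < Real.exp (-(mu * r)) := Real.exp_pos _
    have h3 : 0 ≤ al * rho := mul_nonneg hal0 hrho
    simp only [hZ, relax]
    constructor <;> nlinarith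
  have hZc : Continuous Z := continuous_relax _ _ _
  have hg : IntervalIntegrable (fun r => mu * (Z r - (X r + Y r))) volume 0 T :=
    ((hZc.intervalIntegrable _ _).sub (h.int_X.add h.int_Y)).const_mul mu
  have hinc : ∀ s t, 0 ≤ s → s ≤ t → t ≤ T →
      |(X t + Y t - Z t) - (X s + Y s - Z s) - ∫ r in s..t, mu * (Z r - (X r + Y r))|
        ≤ 4 * η := by
    intro s t hs hst ht
    have h1 := abs_le.1 (h.increment_X hs hst ht)
    have h2 := abs_le.1 (h.increment_Y hs hst ht)
    have h3 := relax_sub_eq_integral mu rho (al * rho) s t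
    have h4 : ∫ r in s..t, mu * (Z r - (X r + Y r)) =
        (∫ r in s..t, (ν r - mu * X r)) + (∫ r in s..t, (lam - ν r - mu * Y r)) -
          ∫ r in s..t, mu * (rho - Z r) := by
      rw [← intervalIntegral.integral_add (intervalIntegrable_of_le h.int_balance_X hs hst ht)
        (intervalIntegrable_of_le h.int_balance_Y hs hst ht), ← intervalIntegral.integral_sub]
      · refine intervalIntegral.integral_congr fun r _ => ?_
        simp only [hlam]
        ring
      · exact (intervalIntegrable_of_le h.int_balance_X hs hst ht).add
          (intervalIntegrable_of_le h.int_balance_Y hs hst ht)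
      · apply Continuous.intervalIntegrable; fun_prop
    rw [abs_le]
    constructor <;> linarith
  -- Subtracting η absorbs the initial error of Y. The two balance errors of 2η each give c = 4η, so
  -- the total is 2 · 4η + η = 9η.
  have hup := le_two_mul_of_barrier (f := fun t => X t + Y t - Z t - η)
    (g := fun r => mu * (Z r - (X r + Y r))) (c := 4 * η) (L := mu * rho)
    (by simp only [h.X_zero, hZ0]; linarith) hg
    (fun r hr _ => mul_le_mul_of_nonneg_left
      (by linarith [(hZle r hr).2, h.X_nonneg r, h.Y_nonneg r]) hmu.le)
    (fun r _ _ hf => mul_nonpos_of_nonneg_of_nonpos hmu.le (by linarith))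
    (fun s t hs hst ht => by linarith [(abs_le.1 (hinc s t hs hst ht)).2]) ht0 htT
  have hlow := le_two_mul_of_barrier (f := fun t => Z t - (X t + Y t) - η)
    (g := fun r => -(mu * (Z r - (X r + Y r)))) (c := 4 * η)
    (L := mu * (2 * L - (1 - al) * rho))
    (by simp only [h.X_zero, hZ0]; linarith) hg.neg
    (fun r hr hrT => by
      rw [← mul_neg]
      exact mul_le_mul_of_nonneg_left
        (by linarith [(hZle r hr).1, (hL r hr hrT).1, (hL r hr hrT).2]) hmu.le)
    (fun r _ _ hf => by
      rw [← mul_neg]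
      exact mul_nonpos_of_nonneg_of_nonpos hmu.le (by linarith))
    (fun s t hs hst ht => by
      rw [intervalIntegral.integral_neg]
      linarith [(abs_le.1 (hinc s t hs hst ht)).1]) ht0 htT
  rw [abs_le]
  constructor <;> linarith

/-- The occupancy of system 0 never exceeds that of the system that admits everything. -/
lemma le_free (hmu : 0 < mu) (hrho : 0 ≤ rho) (hlam : lam = mu * rho)
    {t : ℝ} (ht0 : 0 ≤ t) (htT : t ≤ T) : X t ≤ relax mu rho rho t + 4 * η := by
  set Φ := relax mu rho rho with hΦ
  have hΦ0 : Φ 0 = 0 := by simp [hΦ, relax]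
  have hΦle : ∀ r, Φ r ≤ rho := fun r => by
    simp only [hΦ, relax]
    linarith [mul_nonneg hrho (Real.exp_pos (-(mu * r))).le]
  have hΦc : Continuous Φ := continuous_relax _ _ _
  have hg : IntervalIntegrable (fun r => mu * (Φ r - X r)) volume 0 T :=
    ((hΦc.intervalIntegrable _ _).sub h.int_X).const_mul mu
  have hup := le_two_mul_of_barrier (f := fun t => X t - Φ t)
    (g := fun r => mu * (Φ r - X r)) (c := 2 * η) (L := mu * rho)
    (by simp only [h.X_zero, hΦ0]; linarith) hg
    (fun r _ _ => mul_le_mul_of_nonneg_left (by linarith [hΦle r, h.X_nonneg r]) hmu.le)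
    (fun r _ _ hf => mul_nonpos_of_nonneg_of_nonpos hmu.le (by linarith))
    (fun s t hs hst ht => by
      have h1 := (abs_le.1 (h.increment_X hs hst ht)).2
      have h2 := relax_sub_eq_integral mu rho rho s t
      have h3 : (∫ r in s..t, (ν r - mu * X r)) - (∫ r in s..t, mu * (rho - Φ r)) ≤
          ∫ r in s..t, mu * (Φ r - X r) := by
        rw [← intervalIntegral.integral_sub (intervalIntegrable_of_le h.int_balance_X hs hst ht)
          (by apply Continuous.intervalIntegrable; fun_prop)]
        refine intervalIntegral.integral_mono_on hst
          ((intervalIntegrable_of_le h.int_balance_X hs hst ht).sub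
            (by apply Continuous.intervalIntegrable; fun_prop))
          (intervalIntegrable_of_le hg hs hst ht) fun r _ => ?_
        have := (h.nu_mem r).2
        nlinarith
      linarith) ht0 htT
  linarith

/-- If nothing is admitted above the level `al (X + Y) + κ`, then the occupancy of system 0 stays
below the fluid limit of that level. -/
lemma le_threshold (hmu : 0 < mu) (hrho : 0 ≤ rho) (hlam : lam = mu * rho) (hal0 : 0 ≤ al)
    (hal1 : al ≤ 1) {κ : ℝ}
    (hrej : ∀ t, 0 ≤ t → t ≤ T → al * (X t + Y t) + κ < X t → ν t = 0)
    {t : ℝ} (ht0 : 0 ≤ t) (htT : t ≤ T) :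
    X t ≤ max 0 (relax mu (al * rho + κ) (al ^ 2 * rho) t) + 13 * η := by
  have hη := h.eta_nonneg
  set Θ := relax mu (al * rho + κ) (al ^ 2 * rho) with hΘ
  have hΘmono : Monotone Θ := fun s r hsr => by
    simp only [hΘ, relax]
    have : Real.exp (-(mu * r)) ≤ Real.exp (-(mu * s)) := Real.exp_le_exp.2 (by nlinarith)
    have h3 : 0 ≤ al ^ 2 * rho := by positivity
    nlinarith
  have hrej' : ∀ r, 0 ≤ r → r ≤ T → Θ r + 9 * η < X r → ν r = 0 := fun r hr hrT hX => by
    refine hrej r hr hrT ?_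
    have h1 := (abs_le.1 (h.abs_total_sub_le hmu hrho hlam hal0 hr hrT)).2
    -- The threshold evaluated along the fluid limit of the total is exactly Θ.
    have h2 : al * relax mu rho (al * rho) r + κ = Θ r := by simp only [hΘ, relax]; ring
    have h3 := mul_le_mul_of_nonneg_left h1 hal0
    have h4 : al * (9 * η) ≤ 9 * η := mul_le_of_le_one_left (by linarith) hal1
    nlinarith
  -- The level is cut off at 0 because Θ can start negative while X starts at 0. It is
  -- nondecreasing, so subtracting it preserves upper bounds on increments. The 13η is 9η from the
  -- total plus 2 · 2η.
  have hup := le_two_mul_of_barrier (f := fun t => X t - max 0 (Θ t) - 9 * η)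
    (g := fun r => ν r - mu * X r) (c := 2 * η) (L := lam)
    (by
      simp only [h.X_zero]
      linarith [le_max_left 0 (Θ 0)]) h.int_balance_X
    (fun r _ _ => by linarith [(h.nu_mem r).2, mul_nonneg hmu.le (h.X_nonneg r)])
    (fun r hr hrT hf => by
      rw [hrej' r hr hrT (by linarith [le_max_right 0 (Θ r)])]
      linarith [mul_nonneg hmu.le (h.X_nonneg r)])
    (fun s t hs hst ht => by
      have h1 := (abs_le.1 (h.increment_X hs hst ht)).2
      have h2 : max 0 (Θ s) ≤ max 0 (Θ t) := max_le_max le_rfl (hΘmono hst)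
      linarith) ht0 htT
  linarith

/-- If everything is admitted below the level `al (X + Y) + κ`, then the occupancy of system 0
stays above the fluid limit of that level, as long as it is attainable. -/
lemma threshold_le (hmu : 0 < mu) (hrho : 0 ≤ rho) (hlam : lam = mu * rho) (hal0 : 0 ≤ al)
    (hal1 : al ≤ 1) {κ : ℝ}
    (hadm : ∀ t, 0 ≤ t → t ≤ T → X t < al * (X t + Y t) + κ → ν t = lam)
    {t : ℝ} (ht0 : 0 ≤ t) (htT : t ≤ T) :
    min (relax mu rho rho t) (relax mu (al * rho + κ) (al ^ 2 * rho) t) ≤ X t + 13 * η := by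
  have hη := h.eta_nonneg
  obtain ⟨L, hL⟩ := h.bounded
  set Φ := relax mu rho rho with hΦ
  set Θ := relax mu (al * rho + κ) (al ^ 2 * rho) with hΘ
  -- Growth of the lower barrier must not exceed μ(ρ - H), which requires a relaxation level of at
  -- most ρ. Truncation does not change the minimum: when the level exceeds ρ, Φ is the smaller
  -- curve either way.
  set K := min (al * rho + κ) rho with hK
  set Θ' := relax mu K (al ^ 2 * rho) with hΘ'
  have hΦc : Continuous Φ := continuous_relax _ _ _
  have hΘc' : Continuous Θ' := continuous_relax _ _ _
  have hal2 : al ^ 2 * rho ≤ rho := mul_le_of_le_one_left hrho (pow_le_one₀ hal0 hal1)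
  have hmin : ∀ r, min (Φ r) (Θ r) = min (Φ r) (Θ' r) := fun r => by
    rcases le_total (al * rho + κ) rho with hle | hle
    · rw [hΘ', hK, min_eq_left hle]
    · have he := Real.exp_pos (-(mu * r))
      have h1 : Φ r ≤ Θ' r := by
        rw [hΘ', hK, min_eq_right hle]
        simp only [hΦ, relax]
        nlinarith
      have h2 : Θ' r ≤ Θ r := by
        rw [hΘ', hK, min_eq_right hle]
        simp only [hΘ, relax]
        linarith
      rw [min_eq_left h1, min_eq_left (h1.trans h2)]
  set H := fun r => min (Φ r) (Θ' r) with hH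
  have hHc : Continuous H := hΦc.min hΘc'
  have hH0 : H 0 ≤ 0 := (min_le_left _ _).trans (by simp [hΦ, relax])
  -- The branch attaining the minimum at s bounds H from above at all later times, and relaxes
  -- towards a level of at most ρ.
  have hHinc : ∀ s t, s ≤ t → H t - H s ≤ ∫ r in s..t, mu * (rho - H r) := by
    intro s t hst
    have hi : ∀ F : ℝ → ℝ, Continuous F → ∀ A,
        IntervalIntegrable (fun r => mu * (A - F r)) volume s t := fun F hF A => by
      apply Continuous.intervalIntegrable; fun_prop
    rcases le_total (Φ s) (Θ' s) with hle | hle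
    · have h1 : H s = Φ s := min_eq_left hle
      have h2 := relax_sub_eq_integral mu rho rho s t
      have h3 : ∫ r in s..t, mu * (rho - Φ r) ≤ ∫ r in s..t, mu * (rho - H r) :=
        intervalIntegral.integral_mono_on hst (hi Φ hΦc _) (hi H hHc _) fun r _ =>
          mul_le_mul_of_nonneg_left (by linarith [min_le_left (Φ r) (Θ' r)]) hmu.le
      have h4 : H t ≤ Φ t := min_le_left _ _
      linarith
    · have h1 : H s = Θ' s := min_eq_right hle
      have h2 := relax_sub_eq_integral mu K (al ^ 2 * rho) s t
      have h3 : ∫ r in s..t, mu * (K - Θ' r) ≤ ∫ r in s..t, mu * (rho - H r) :=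
        intervalIntegral.integral_mono_on hst (hi Θ' hΘc' _) (hi H hHc _) fun r _ =>
          mul_le_mul_of_nonneg_left
            (by linarith [min_le_right (Φ r) (Θ' r), min_le_right (al * rho + κ) rho]) hmu.le
      have h4 : H t ≤ Θ' t := min_le_right _ _
      linarith
  have hadm' : ∀ r, 0 ≤ r → r ≤ T → X r + 9 * η < H r → ν r = lam := fun r hr hrT hX => by
    refine hadm r hr hrT ?_
    have h0 : H r ≤ Θ r := by
      have := hmin r
      exact this.symm.le.trans (min_le_right _ _)
    have h1 := (abs_le.1 (h.abs_total_sub_le hmu hrho hlam hal0 hr hrT)).1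
    have h2 : al * relax mu rho (al * rho) r + κ = Θ r := by simp only [hΘ, relax]; ring
    have h3 := mul_le_mul_of_nonneg_left h1 hal0
    have h4 : al * (9 * η) ≤ 9 * η := mul_le_of_le_one_left (by linarith) hal1
    nlinarith
  have hHint : IntervalIntegrable (fun r => mu * (rho - H r)) volume 0 T := by
    apply Continuous.intervalIntegrable; fun_prop
  obtain ⟨A, hA⟩ : ∃ A, ∀ r, 0 ≤ r → r ≤ T → mu * (rho - H r) ≤ A := by
    have hcont : Continuous fun r => mu * (rho - H r) := by fun_prop
    obtain ⟨A, hA⟩ := (isCompact_Icc (a := (0 : ℝ)) (b := T)).bddAbove_image hcont.continuousOn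
    exact ⟨A, fun r hr hrT => hA ⟨r, ⟨hr, hrT⟩, rfl⟩⟩
  have hup := le_two_mul_of_barrier (f := fun t => H t - X t - 9 * η)
    (g := fun r => mu * (rho - H r) - (ν r - mu * X r)) (c := 2 * η) (L := A + mu * L)
    (by simp only [h.X_zero]; linarith) (hHint.sub h.int_balance_X)
    (fun r hr hrT => by
      linarith [hA r hr hrT, (h.nu_mem r).1,
        mul_le_mul_of_nonneg_left (hL r hr hrT).1 hmu.le])
    (fun r hr hrT hf => by
      have h1 := hadm' r hr hrT (by linarith)
      rw [h1, hlam]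
      nlinarith)
    (fun s t hs hst ht => by
      have h1 := (abs_le.1 (h.increment_X hs hst ht)).1
      have h2 := hHinc s t hst
      rw [intervalIntegral.integral_sub (intervalIntegrable_of_le hHint hs hst ht)
        (intervalIntegrable_of_le h.int_balance_X hs hst ht)]
      linarith) ht0 htT
  rw [hmin t]
  have : H t ≤ X t + 13 * η := by linarith
  exact this

end ApproxFlow

end Fluid

/-! ### Law of large numbers for Poisson clocks -/

/-- Since n / n! = 1 / (n - 1)!, shifting the index leaves r times the total mass. -/
lemma hasSum_poisson_mean (r : ℝ≥0) :
    HasSum (fun n : ℕ => Real.exp (-r) * r ^ n / (n.factorial : ℝ) * n) r := by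
  refine (hasSum_nat_add_iff' 1).1 ?_
  have h := (hasSum_one_poissonMeasure r).mul_left (r : ℝ)
  rw [mul_one] at h
  simp only [Finset.range_one, Finset.sum_singleton, Nat.cast_zero, mul_zero, sub_zero]
  refine h.congr_fun fun n => ?_
  have h1 : (n.factorial : ℝ) ≠ 0 := by positivity
  have h2 : (n : ℝ) + 1 ≠ 0 := by positivity
  rw [Nat.factorial_succ]
  push_cast
  field_simp
  ring

lemma integrable_id_poissonMeasure (r : ℝ≥0) :
    Integrable (fun n : ℕ => (n : ℝ)) (poissonMeasure r) := by
  rw [integrable_poissonMeasure_iff]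
  simpa using (hasSum_poisson_mean r).summable

lemma integral_id_poissonMeasure (r : ℝ≥0) :
    ∫ n : ℕ, (n : ℝ) ∂(poissonMeasure r) = r := by
  rw [integral_poissonMeasure]
  simpa using (hasSum_poisson_mean r).tsum_eq

/-- At integer times the process is a sum of independent Poisson(1) increments, so the strong law
applies. Monotonicity makes the truncated subtraction in `D` genuine, so the sum telescopes. -/
lemma IsUnitPoisson.tendsto_div {Ω : Type*} [MeasurableSpace Ω] {P : Measure Ω}
    [IsProbabilityMeasure P] {N : ℝ≥0 → Ω → ℕ} (hN : IsUnitPoisson P N) :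
    ∀ᵐ ω ∂P, Tendsto (fun n : ℕ => (N n ω : ℝ) / n) atTop (𝓝 1) := by
  set D : ℕ → Ω → ℕ := fun n ω => N ((n + 1 : ℕ) : ℝ≥0) ω - N (n : ℝ≥0) ω with hD
  have hlaw : ∀ n, HasLaw (D n) (poissonMeasure 1) P := fun n => by
    have h := hN.increments n (n + 1 : ℕ) (by simp)
    simpa [hD] using h
  have hind : iIndepFun D P :=
    hN.indep.nat (t := fun n : ℕ => (n : ℝ≥0)) Nat.mono_cast
  have hcast : Measurable (fun n : ℕ => (n : ℝ)) := measurable_from_top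
  have hint : Integrable (fun ω => (D 0 ω : ℝ)) P := by
    have := (hlaw 0).map_eq ▸ integrable_id_poissonMeasure 1
    exact this.comp_aemeasurable (hlaw 0).aemeasurable
  have hmean : ∫ ω, (D 0 ω : ℝ) ∂P = 1 := by
    have := integral_map (μ := P) (hlaw 0).aemeasurable (f := fun n : ℕ => (n : ℝ))
      hcast.aestronglyMeasurable
    rw [← this, (hlaw 0).map_eq, integral_id_poissonMeasure]
    simp
  have hslln := strong_law_ae_real (fun n ω => (D n ω : ℝ)) hint
    (fun i j hij => (hind.indepFun hij).comp hcast hcast)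
    (fun i => IdentDistrib.comp ⟨(hlaw i).aemeasurable, (hlaw 0).aemeasurable,
      by rw [(hlaw i).map_eq, (hlaw 0).map_eq]⟩ hcast)
  filter_upwards [hslln, hN.zero, hN.paths] with ω h h0 hp
  rw [hmean] at h
  refine h.congr fun n => ?_
  congr 1
  induction n with
  | zero => simp [h0]
  | succ k ih =>
    have hle : N (k : ℝ≥0) ω ≤ N ((k + 1 : ℕ) : ℝ≥0) ω := hp.1 (by simp)
    rw [Finset.sum_range_succ, ih, hD]
    simp only [Nat.cast_sub hle]
    ring

/-- A monotone path with long run rate one deviates sublinearly from the identity. -/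
lemma exists_abs_sub_le_of_tendsto_div {N : ℝ≥0 → ℕ} (hmono : Monotone N)
    (hlim : Tendsto (fun n : ℕ => (N n : ℝ) / n) atTop (𝓝 1)) {δ : ℝ} (hδ : 0 < δ) :
    ∃ C : ℝ, ∀ t : ℝ≥0, |(N t : ℝ) - t| ≤ δ * t + C := by
  obtain ⟨k₀, hk₀⟩ := (Metric.tendsto_atTop.1 hlim) δ hδ
  have hint : ∀ k : ℕ, |(N k : ℝ) - k| ≤ δ * k + (N k₀ + k₀) := fun k => by
    rcases le_total k₀ k with h | h
    · rcases Nat.eq_zero_or_pos k with h0 | h0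
      · subst h0
        obtain rfl : k₀ = 0 := by omega
        simp
      · have := hk₀ k h
        have hk : (0 : ℝ) < k := by exact_mod_cast h0
        rw [Real.dist_eq, div_sub_one hk.ne', abs_div, abs_of_pos hk, div_lt_iff₀ hk] at this
        have : (0 : ℝ) ≤ N k₀ + k₀ := by positivity
        linarith
    · have h1 : (N k : ℝ) ≤ N k₀ := by exact_mod_cast hmono (by exact_mod_cast h)
      have h2 : (k : ℝ) ≤ k₀ := by exact_mod_cast h
      have h3 : 0 ≤ δ * k := by positivity
      have h4 : (0 : ℝ) ≤ N k := by positivity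
      have h5 : (0 : ℝ) ≤ k := by positivity
      rw [abs_le]
      constructor <;> linarith
  refine ⟨δ + (N k₀ + k₀) + 1, fun t => ?_⟩
  set k := ⌊t⌋₊ with hk
  have hkt : (k : ℝ≥0) ≤ t := Nat.floor_le (by positivity)
  have htk : t ≤ ((k + 1 : ℕ) : ℝ≥0) := by exact_mod_cast (Nat.lt_floor_add_one t).le
  have h1 := abs_le.1 (hint k)
  have h2 := abs_le.1 (hint (k + 1))
  have h3 : (N k : ℝ) ≤ N t := by exact_mod_cast hmono hkt
  have h4 : (N t : ℝ) ≤ N ((k + 1 : ℕ) : ℝ≥0) := by exact_mod_cast hmono htk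
  have h5 : (k : ℝ) ≤ t := by exact_mod_cast hkt
  have h6 : (t : ℝ) ≤ k + 1 := by exact_mod_cast htk
  push_cast at h2 h4
  have h7 : δ * k ≤ δ * t := mul_le_mul_of_nonneg_left h5 hδ.le
  rw [abs_le]
  constructor <;> linarith

/-! ### The admission threshold -/

lemma penaltyTerm_slope {β bi c z : ℝ} (hc : c ≠ 0) :
    penaltySlope β bi c z = ((β * bi / c * Real.exp (β * (bi * z / c)) : ℝ) : EReal) := by
  rw [penaltySlope, if_neg hc]
  congr 1
  have h1 : HasDerivAt (fun w => β * (bi * w / c)) (β * (bi * 1 / c)) z :=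
    (((hasDerivAt_id z).const_mul bi).div_const c).const_mul β
  have h2 : HasDerivAt (fun w => penaltyTerm β bi c w)
      (Real.exp (β * (bi * z / c)) * (β * (bi * 1 / c))) z := h1.exp
  rw [h2.deriv]
  ring

/-- The comparison of penalty slopes is a threshold rule in the occupancy of system 0. -/
lemma penaltySlope_le_iff {β bi rho γ al x y : ℝ} (hβ : 0 < β) (hbi : 0 < bi) (hrho : 0 < rho)
    (hγ : 0 < γ) (hal0 : 0 < al) (hal1 : al < 1) :
    penaltySlope β bi (γ * al * bi * rho) x ≤ penaltySlope β bi (γ * (1 - al) * bi * rho) y ↔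
      x ≤ al * (x + y) + al * (1 - al) * rho * (γ / β * Real.log (al / (1 - al))) := by
  have hal1' : 0 < 1 - al := by linarith
  have h0 : 0 < γ * al * bi * rho := by positivity
  have h1 : 0 < γ * (1 - al) * bi * rho := by positivity
  -- After taking logarithms both sides are affine in x and y; multiplying by α(1 - α)ργ/β gives the
  -- threshold.
  rw [penaltyTerm_slope h0.ne', penaltyTerm_slope h1.ne', EReal.coe_le_coe_iff,
    ← Real.log_le_log_iff (by positivity) (by positivity),
    Real.log_mul (by positivity) (Real.exp_pos _).ne',
    Real.log_mul (by positivity) (Real.exp_pos _).ne', Real.log_exp, Real.log_exp]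
  have hlog : Real.log (β * bi / (γ * (1 - al) * bi * rho)) =
      Real.log (β * bi / (γ * al * bi * rho)) + Real.log (al / (1 - al)) := by
    rw [← Real.log_mul (by positivity) (by positivity)]
    congr 1
    field_simp
  have hx : β * (bi * x / (γ * al * bi * rho)) =
      (1 - al) * x * (β / (al * (1 - al) * rho * γ)) := by
    field_simp
  have hy : β * (bi * y / (γ * (1 - al) * bi * rho)) =
      al * y * (β / (al * (1 - al) * rho * γ)) := by
    field_simp
  have hP : 0 < β / (al * (1 - al) * rho * γ) := by positivity
  have hl : Real.log (al / (1 - al)) =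
      al * (1 - al) * rho * (γ / β * Real.log (al / (1 - al))) *
        (β / (al * (1 - al) * rho * γ)) := by
    field_simp
  rw [hlog, hx, hy]
  constructor
  · intro h
    by_contra! hlt
    have := mul_lt_mul_of_pos_right
      (show al * y + al * (1 - al) * rho * (γ / β * Real.log (al / (1 - al))) < (1 - al) * x by
        linarith) hP
    rw [add_mul, ← hl] at this
    linarith
  · intro h
    have := mul_le_mul_of_nonneg_right
      (show (1 - al) * x ≤ al * y + al * (1 - al) * rho * (γ / β * Real.log (al / (1 - al))) by
        linarith) hP.le
    rw [add_mul, ← hl] at this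
    linarith

/-- For ε < 1/4 one has 2/ε > 8 > e, so the logarithm is at least 1. Only this linear growth of β in
1/ε is needed later. -/
lemma two_div_add_four_le_penaltyBeta {ε : ℝ} (hε : 0 < ε) (hε' : ε < 1 / 4) :
    2 / ε + 4 ≤ penaltyBeta ε := by
  have h8 : 8 ≤ 2 / ε := by
    rw [le_div_iff₀ hε]; linarith
  have h1 : 1 ≤ Real.log (2 / ε) := by
    rw [Real.le_log_iff_exp_le (by positivity)]
    linarith [Real.exp_one_lt_d9]
  have h2 : 2 / ε * 1 ≤ 2 / ε * Real.log (2 / ε) :=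
    mul_le_mul_of_nonneg_left h1 (by positivity)
  rw [penaltyBeta]
  linarith

lemma penaltyBeta_pos {ε : ℝ} (hε : 0 < ε) (hε' : ε < 1 / 4) : 0 < penaltyBeta ε := by
  have := two_div_add_four_le_penaltyBeta hε hε'
  have : 0 < 2 / ε := by positivity
  linarith

lemma div_penaltyBeta_le {ε : ℝ} (hε : 0 < ε) (hε' : ε < 1 / 4) :
    (1 + 4 * ε) / penaltyBeta ε ≤ ε := by
  have h := two_div_add_four_le_penaltyBeta hε hε'
  rw [div_le_iff₀ (penaltyBeta_pos hε hε')]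
  have h2 : ε * (2 / ε + 4) ≤ ε * penaltyBeta ε := mul_le_mul_of_nonneg_left h hε.le
  have h3 : ε * (2 / ε + 4) = 2 + 4 * ε := by field_simp
  linarith

/-- From log z ≤ z - 1. Having `a` on the right, rather than a constant, makes the excess of class i
proportional to α_i ρ_i, so it can be summed against the capacity constraint. -/
lemma mul_log_odds_le {a : ℝ} (h0 : 0 ≤ a) (h1 : a ≤ 1) :
    a * (1 - a) * Real.log (a / (1 - a)) ≤ a := by
  rcases eq_or_lt_of_le h0 with rfl | h0
  · simp
  rcases eq_or_lt_of_le h1 with rfl | h1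
  · simp
  have h2 : 0 < 1 - a := by linarith
  have h3 := mul_le_mul_of_nonneg_left (Real.log_le_sub_one_of_pos (div_pos h0 h2))
    (mul_pos h0 h2).le
  have h4 : a * (1 - a) * (a / (1 - a) - 1) = a * (2 * a - 1) := by
    field_simp
    ring
  nlinarith

/-- The log odds change sign under a ↦ 1 - a, so this is the previous bound reflected. -/
lemma neg_one_le_mul_log_odds {a : ℝ} (h0 : 0 ≤ a) (h1 : a ≤ 1) :
    -1 ≤ a * (1 - a) * Real.log (a / (1 - a)) := by
  have h := mul_log_odds_le (a := 1 - a) (by linarith) (by linarith)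
  rw [sub_sub_cancel, ← inv_div, Real.log_inv] at h
  nlinarith

/-! ### The fluid occupancy and the threshold rule in the scaled systems -/

namespace Model

variable {m : ℕ}

/-- Offset of the admission threshold of class `i` (per unit of scale): the penalty policy admits
class `i` requests iff `x_i ≤ α_i (x_i + y_i) + thresholdShift`. -/
def thresholdShift (M : Model m) (ε : ℝ) (α : Fin m → ℝ) (i : Fin m) : ℝ :=
  α i * (1 - α i) * M.rho i *
    ((1 + 4 * ε) / penaltyBeta ε * Real.log (α i / (1 - α i)))

/-- The fluid limit of the scaled number of class `i` requests in system 0. -/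
def fluidOccupancy (M : Model m) (ε : ℝ) (α : Fin m → ℝ) (i : Fin m) (t : ℝ) : ℝ :=
  max 0 (min (relax (M.mu i) (M.rho i) (M.rho i) t)
    (relax (M.mu i) (α i * M.rho i + M.thresholdShift ε α i) (α i ^ 2 * M.rho i) t))

variable {M : Model m} {ε : ℝ} {α : Fin m → ℝ}

lemma Valid.thresholdShift_le (hM : M.Valid) (hε : 0 < ε) (hε' : ε < 1 / 4) {i : Fin m}
    (hα : 0 ≤ α i ∧ α i ≤ 1) :
    M.thresholdShift ε α i ≤ α i * M.rho i * ((1 + 4 * ε) / penaltyBeta ε) := by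
  have h := mul_log_odds_le hα.1 hα.2
  have hβ := penaltyBeta_pos hε hε'
  have hρ := hM.rho_pos i
  have hp : 0 ≤ M.rho i * ((1 + 4 * ε) / penaltyBeta ε) := by positivity
  have := mul_le_mul_of_nonneg_right h hp
  rw [thresholdShift]
  linarith

lemma Valid.neg_le_thresholdShift (hM : M.Valid) (hε : 0 < ε) (hε' : ε < 1 / 4) {i : Fin m}
    (hα : 0 ≤ α i ∧ α i ≤ 1) : -(M.rho i * ε) ≤ M.thresholdShift ε α i := by
  have h := neg_one_le_mul_log_odds hα.1 hα.2
  have hβ := penaltyBeta_pos hε hε'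
  have hρ := hM.rho_pos i
  have hp : 0 ≤ M.rho i * ((1 + 4 * ε) / penaltyBeta ε) := by positivity
  have h1 := mul_le_mul_of_nonneg_right h hp
  have h2 := mul_le_mul_of_nonneg_left (div_penaltyBeta_le hε hε') hρ.le
  rw [thresholdShift]
  linarith

lemma Valid.relax_free_nonneg (hM : M.Valid) (i : Fin m) {t : ℝ} (ht : 0 ≤ t) :
    0 ≤ relax (M.mu i) (M.rho i) (M.rho i) t := by
  have h1 : Real.exp (-(M.mu i * t)) ≤ 1 :=
    Real.exp_le_one_iff.2 (by linarith [mul_nonneg (hM.mu_pos i).le ht])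
  have := mul_le_mul_of_nonneg_left h1 (hM.rho_pos i).le
  rw [relax]
  linarith

lemma Valid.fluidOccupancy_le (hM : M.Valid) (hε : 0 < ε) (hε' : ε < 1 / 4) {i : Fin m}
    (hα : 0 ≤ α i ∧ α i ≤ 1) (t : ℝ) :
    M.fluidOccupancy ε α i t ≤ α i * M.rho i * (1 + (1 + 4 * ε) / penaltyBeta ε) := by
  have hβ := penaltyBeta_pos hε hε'
  have hρ := hM.rho_pos i
  have h0 := hα.1
  have h1 := hM.thresholdShift_le hε hε' hα
  have h2 : 0 ≤ α i ^ 2 * M.rho i * Real.exp (-(M.mu i * t)) := by positivity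
  refine max_le (by positivity) ((min_le_right _ _).trans ?_)
  rw [relax]
  linarith

/-- Both branches of the minimum lie above the target: the free curve since α ≤ 1, the threshold
curve since α² ≤ α and its offset is at least -ρε. -/
lemma Valid.le_fluidOccupancy (hM : M.Valid) (hε : 0 < ε) (hε' : ε < 1 / 4) {i : Fin m}
    (hα : 0 ≤ α i ∧ α i ≤ 1) {t : ℝ} (ht : 0 ≤ t) :
    M.rho i * α i * (1 - Real.exp (-(M.mu i * t))) - M.rho i * ε ≤ M.fluidOccupancy ε α i t := by
  have hρ := hM.rho_pos i
  have h1 := hM.neg_le_thresholdShift hε hε' hα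
  have he : 0 < Real.exp (-(M.mu i * t)) := Real.exp_pos _
  have hφ := hM.relax_free_nonneg i ht
  refine le_max_of_le_right (le_min ?_ ?_)
  · rw [relax] at hφ ⊢
    have := mul_le_mul_of_nonneg_right hα.2 hφ
    have : 0 < M.rho i * ε := mul_pos hρ hε
    linarith
  · have h2 : α i ^ 2 ≤ α i := by nlinarith [hα.1, hα.2]
    have := mul_le_mul_of_nonneg_right h2 (mul_pos hρ he).le
    rw [relax]
    linarith

/-- The fluid limit leaves a fixed part of the capacity unused. -/
lemma Valid.sum_size_mul_fluidOccupancy_lt (hM : M.Valid) (hε : 0 < ε) (hε' : ε < 1 / 4)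
    (hα : M.PrimalFeasible (M.perturbedCap ε) α) :
    ∃ b' < M.b, ∀ t, ∑ i, M.size i * M.fluidOccupancy ε α i t ≤ b' := by
  have hβ := penaltyBeta_pos hε hε'
  have hβ2 := two_div_add_four_le_penaltyBeta hε hε'
  set q := (1 + 4 * ε) / penaltyBeta ε with hq
  have hq0 : 0 < q := by positivity
  refine ⟨(1 + q) * M.perturbedCap ε, ?_, fun t => ?_⟩
  -- This strict inequality makes (1 + q) b/(1 + 4ε) smaller than b: the slack put into the
  -- perturbed capacity exceeds the overshoot of the thresholds.
  · have hqlt : q < 4 * ε := by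
      rw [hq, div_lt_iff₀ hβ]
      have h1 : ε * (2 / ε + 4) ≤ ε * penaltyBeta ε := mul_le_mul_of_nonneg_left hβ2 hε.le
      have h2 : ε * (2 / ε + 4) = 2 + 4 * ε := by field_simp
      linarith
    rw [perturbedCap, mul_div_assoc', div_lt_iff₀ (by linarith)]
    nlinarith [hM.b_pos]
  · have h1 : ∑ i, M.size i * M.fluidOccupancy ε α i t ≤
        ∑ i, (1 + q) * (M.size i * M.rho i * α i) :=
      Finset.sum_le_sum fun i _ => by
        have := mul_le_mul_of_nonneg_left (hM.fluidOccupancy_le hε hε' (hα.2 i) t)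
          (hM.size_pos i).le
        linarith
    rw [← Finset.mul_sum] at h1
    exact h1.trans (mul_le_mul_of_nonneg_left hα.1 (by linarith))

lemma scale_rho (M : Model m) (n : ℕ) (i : Fin m) : (M.scale n).rho i = n * M.rho i := by
  simp only [rho, scale, mul_div_assoc]

/-- Above the threshold, nothing is admitted. -/
lemma Valid.not_admits_scale (hM : M.Valid) (hε : 0 < ε) (hε' : ε < 1 / 4) {i : Fin m}
    (hα : 0 ≤ α i ∧ α i ≤ 1) {n : ℕ} (hn : 1 ≤ n) {x y : Fin m → ℕ}
    (h : α i * ((x i : ℝ) / n + (y i : ℝ) / n) + M.thresholdShift ε α i < (x i : ℝ) / n) :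
    ¬ (M.scale n).Admits ε α x y i := by
  have hn0 : (0 : ℝ) < n := by exact_mod_cast hn
  have hb := hM.size_pos i
  have hρ := hM.rho_pos i
  have hβ := penaltyBeta_pos hε hε'
  rintro ⟨hs, -⟩
  have hsz : 0 < (M.scale n).size i := div_pos hb hn0
  have hrh : 0 < (M.scale n).rho i := by rw [scale_rho]; positivity
  -- At α_i = 0 the slope of system 0 is infinite and that of system 1 finite, so nothing is
  -- admitted. At α_i = 1 the offset vanishes and x can never exceed x + y.
  rcases eq_or_lt_of_le hα.1 with h0 | h0
  · have hc : (1 + 4 * ε) * (1 - α i) * (M.scale n).size i * (M.scale n).rho i ≠ 0 := by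
      rw [← h0, sub_zero, mul_one]; positivity
    rw [target0, target1, penaltyTerm_slope hc, ← h0, penaltySlope, if_pos (by simp)] at hs
    exact absurd hs (not_le.2 (EReal.coe_lt_top _))
  rcases eq_or_lt_of_le hα.2 with h1 | h1
  · have hsh : M.thresholdShift ε α i = 0 := by simp [thresholdShift, h1]
    rw [hsh, h1] at h
    have : (0 : ℝ) ≤ (y i : ℝ) / n := by positivity
    linarith
  · rw [target0, target1, penaltySlope_le_iff hβ hsz hrh (by linarith) h0 h1, scale_rho] at hs
    have h2 := mul_lt_mul_of_pos_right h hn0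
    rw [thresholdShift, div_mul_cancel₀ _ hn0.ne', add_mul, mul_assoc (α i) _ (n : ℝ), add_mul,
      div_mul_cancel₀ _ hn0.ne', div_mul_cancel₀ _ hn0.ne'] at h2
    linarith

/-- Below the threshold, everything is admitted that fits into the capacity. -/
lemma Valid.admits_scale (hM : M.Valid) (hε : 0 < ε) (hε' : ε < 1 / 4) {i : Fin m}
    (hα : 0 ≤ α i ∧ α i ≤ 1) {n : ℕ} (hn : 1 ≤ n) {x y : Fin m → ℕ}
    (h : (x i : ℝ) / n < α i * ((x i : ℝ) / n + (y i : ℝ) / n) + M.thresholdShift ε α i)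
    (hcap : ∑ j, M.size j * ((x j : ℝ) / n) + M.size i / n ≤ M.b) :
    (M.scale n).Admits ε α x y i := by
  have hn0 : (0 : ℝ) < n := by exact_mod_cast hn
  have hb := hM.size_pos i
  have hρ := hM.rho_pos i
  have hβ := penaltyBeta_pos hε hε'
  have hsz : 0 < (M.scale n).size i := div_pos hb hn0
  have hrh : 0 < (M.scale n).rho i := by rw [scale_rho]; positivity
  refine ⟨?_, ?_⟩
  · rcases eq_or_lt_of_le hα.1 with h0 | h0
    · have hsh : M.thresholdShift ε α i = 0 := by simp [thresholdShift, ← h0]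
      rw [hsh, ← h0, zero_mul, zero_add] at h
      exact absurd h (not_lt.2 (by positivity))
    rcases eq_or_lt_of_le hα.2 with h1 | h1
    · rw [target1, h1, penaltySlope.eq_1 _ _ (_ * (1 - 1) * _ * _), if_pos (by simp)]
      exact le_top
    · rw [target0, target1, penaltySlope_le_iff hβ hsz hrh (by linarith) h0 h1, scale_rho]
      have h2 := mul_lt_mul_of_pos_right h hn0
      rw [thresholdShift, div_mul_cancel₀ _ hn0.ne', add_mul, mul_assoc (α i) _ (n : ℝ), add_mul,
        div_mul_cancel₀ _ hn0.ne', div_mul_cancel₀ _ hn0.ne'] at h2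
      linarith
  · have : ∑ j, (M.scale n).size j * (x j : ℝ) = ∑ j, M.size j * ((x j : ℝ) / n) :=
      Finset.sum_congr rfl fun j _ => by simp only [scale]; ring
    rw [this]
    exact hcap

end Model

/-! ### From penalty paths to approximate flows -/

/-- Sampling at the first grid point strictly to the right of t gives step functions that converge
pointwise by right continuity. -/
lemma measurable_of_rightCont {g : ℝ → ℝ} (hg : ∀ t, ContinuousWithinAt g (Set.Ici t) t) :
    Measurable g := by
  refine measurable_of_tendsto_metrizable
    (f := fun (n : ℕ) (t : ℝ) => g (((⌊((n : ℝ) + 1) * t⌋ : ℝ) + 1) / ((n : ℝ) + 1)))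
    (fun n => ?_) (tendsto_pi_nhds.2 fun t => ?_)
  · exact (measurable_from_top (f := fun k : ℤ => g (((k : ℝ) + 1) / ((n : ℝ) + 1)))).comp
      (Int.measurable_floor.comp (measurable_const.mul measurable_id))
  · refine (hg t).tendsto.comp (tendsto_nhdsWithin_iff.2 ⟨?_, Eventually.of_forall fun n => ?_⟩)
    · have hlim : Tendsto (fun n : ℕ => t + 1 / ((n : ℝ) + 1)) atTop (𝓝 t) := by
        simpa using tendsto_one_div_add_atTop_nhds_zero_nat.const_add t
      refine tendsto_of_tendsto_of_tendsto_of_le_of_le tendsto_const_nhds hlim (fun n => ?_)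
        fun n => ?_
      · have hn : (0 : ℝ) < (n : ℝ) + 1 := by positivity
        change t ≤ _
        rw [le_div_iff₀ hn]
        linarith [Int.lt_floor_add_one (((n : ℝ) + 1) * t)]
      · have hn : (0 : ℝ) < (n : ℝ) + 1 := by positivity
        change _ ≤ t + 1 / ((n : ℝ) + 1)
        rw [div_le_iff₀ hn, add_mul t, div_mul_cancel₀ _ hn.ne']
        linarith [Int.floor_le (((n : ℝ) + 1) * t)]
    · have hn : (0 : ℝ) < (n : ℝ) + 1 := by positivity
      change t ≤ _
      rw [le_div_iff₀ hn]
      linarith [Int.lt_floor_add_one (((n : ℝ) + 1) * t)]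

lemma intervalIntegrable_of_rightCont {g : ℝ → ℝ} {T L : ℝ} (hT : 0 ≤ T)
    (hg : ∀ t, 0 ≤ t → ContinuousWithinAt g (Set.Ici t) t)
    (hb : ∀ t, 0 ≤ t → t ≤ T → |g t| ≤ L) : IntervalIntegrable g volume 0 T := by
  have hmeas : Measurable fun t => g (max 0 t) := measurable_of_rightCont fun t => by
    refine ContinuousWithinAt.comp (t := Set.Ici (max 0 t)) (hg _ (le_max_left _ _))
      (by fun_prop) fun s hs => ?_
    exact max_le_max le_rfl (Set.mem_Ici.1 hs)
  have hint : IntegrableOn (fun t => g (max 0 t)) (Set.Ioc 0 T) := by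
    refine Measure.integrableOn_of_bounded (M := L) (by simp) hmeas.aestronglyMeasurable ?_
    refine (ae_restrict_iff' measurableSet_Ioc).2 (Eventually.of_forall fun t ht => ?_)
    rw [max_eq_right ht.1.le]
    exact hb t ht.1.le ht.2
  rw [intervalIntegrable_iff_integrableOn_Ioc_of_le hT]
  refine hint.congr_fun (fun t ht => ?_) measurableSet_Ioc
  simp only [max_eq_right ht.1.le]

namespace Model

variable {m : ℕ} {M : Model m}

lemma Valid.rateX_scale_mem (hM : M.Valid) (n : ℕ) (ε : ℝ) (α : Fin m → ℝ) (x y : Fin m → ℕ)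
    (i : Fin m) : 0 ≤ (M.scale n).rateX ε α x y i ∧
      (M.scale n).rateX ε α x y i ≤ n * M.lam i := by
  have : 0 ≤ n * M.lam i := mul_nonneg n.cast_nonneg (hM.lam_pos i).le
  rw [rateX]
  split_ifs <;> simp [scale, this]

lemma rateY_scale (n : ℕ) (ε : ℝ) (α : Fin m → ℝ) (x y : Fin m → ℕ) (i : Fin m) :
    (M.scale n).rateY ε α x y i = n * M.lam i - (M.scale n).rateX ε α x y i := by
  rw [rateX, rateY]
  split_ifs <;> simp [scale]

end Model

namespace IsPenaltyPath

variable {m : ℕ} {M : Model m} {ε : ℝ} {α : Fin m → ℝ} {y0 : Fin m → ℕ}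
  {N : Clock × Fin m → ℝ≥0 → ℕ} {x y : ℝ → Fin m → ℕ}

/-- The state space is discrete, so every function of the state, including the discontinuous
admission rule, is right continuous along the path. -/
lemma continuousWithinAt_comp (h : IsPenaltyPath M ε α y0 N x y)
    (F : (Fin m → ℕ) → (Fin m → ℕ) → ℝ) {t : ℝ} (ht : 0 ≤ t) :
    ContinuousWithinAt (fun s => F (x s) (y s)) (Set.Ici t) t := by
  have h1 : ContinuousWithinAt x (Set.Ici t) t :=
    continuousWithinAt_pi.2 fun i => h.rightCont_x i t ht
  have h2 : ContinuousWithinAt y (Set.Ici t) t :=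
    continuousWithinAt_pi.2 fun i => h.rightCont_y i t ht
  have hF : Continuous fun p : (Fin m → ℕ) × (Fin m → ℕ) => F p.1 p.2 :=
    continuous_of_discreteTopology
  exact hF.continuousAt.comp_continuousWithinAt (h1.prodMk h2)

/-- If the clocks are close to the identity, then each class of the scaled system is an approximate
flow. -/
lemma approxFlow (hM : M.Valid) {n : ℕ} (hn : 1 ≤ n)
    (h : IsPenaltyPath (M.scale n) ε α y0 N x y) (h0 : ∀ k, N k 0 = 0) {δ C T η : ℝ}
    (hC : ∀ k t, |(N k t : ℝ) - t| ≤ δ * t + C) (hδ0 : 0 ≤ δ) (hδ1 : δ ≤ 1) (hCn : C ≤ n)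
    (hα : ∀ i, 0 ≤ α i ∧ α i ≤ 1)
    (hy0 : ∀ i, |(y0 i : ℝ) - (1 - α i) * (M.scale n).rho i| < 1) (hT : 0 ≤ T) (i : Fin m)
    (hη : δ * (M.lam i * T + M.mu i * T * (M.rho i + 2 * (M.lam i * T) + 2)) + 2 * (C / n) ≤ η)
    (hη1 : 1 / (n : ℝ) ≤ η) :
    ApproxFlow (M.lam i) (M.mu i) (M.rho i) (α i) T η
      (fun t => (M.scale n).rateX ε α (x t) (y t) i / n)
      (fun t => (x t i : ℝ) / n) (fun t => (y t i : ℝ) / n) := by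
  have hn0 : (0 : ℝ) < n := by exact_mod_cast hn
  have hn1 : (1 : ℝ) ≤ n := by exact_mod_cast hn
  have hlam := hM.lam_pos i
  have hmu := hM.mu_pos i
  have hρ := hM.rho_pos i
  set R := fun t => (M.scale n).rateX ε α (x t) (y t) i with hR
  have hRmem : ∀ t, 0 ≤ R t ∧ R t ≤ n * M.lam i := fun t => hM.rateX_scale_mem n ε α _ _ i
  have hRint : IntervalIntegrable R volume 0 T :=
    intervalIntegrable_of_rightCont hT
      (fun t ht => h.continuousWithinAt_comp (fun a b => (M.scale n).rateX ε α a b i) ht)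
      (L := n * M.lam i) fun t _ _ => by
        rw [abs_of_nonneg (hRmem t).1]; exact (hRmem t).2
  -- a clock run at a nonnegative rate, bounded by its mean
  have hclock : ∀ k (g : ℝ → ℝ) (B : ℝ), IntervalIntegrable g volume 0 T →
      (∀ t, 0 ≤ t → t ≤ T → 0 ≤ g t ∧ g t ≤ n * B) → 0 ≤ B → ∀ t, 0 ≤ t → t ≤ T →
      |(N k (∫ s in (0 : ℝ)..t, g s).toNNReal : ℝ) / n - ∫ s in (0 : ℝ)..t, g s / n| ≤
        δ * (B * T) + C / n := by
    intro k g B hg hgB hB t ht htT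
    have hgt := ApproxFlow.intervalIntegrable_of_le hg le_rfl ht htT
    have hpos : 0 ≤ ∫ s in (0 : ℝ)..t, g s :=
      intervalIntegral.integral_nonneg ht fun s hs => (hgB s hs.1 (hs.2.trans htT)).1
    have hle : ∫ s in (0 : ℝ)..t, g s ≤ n * B * T := by
      have h1 : ∫ s in (0 : ℝ)..t, g s ≤ ∫ s in (0 : ℝ)..t, n * B :=
        intervalIntegral.integral_mono_on ht hgt (by simp) fun s hs =>
          (hgB s hs.1 (hs.2.trans htT)).2
      rw [intervalIntegral.integral_const, sub_zero, smul_eq_mul] at h1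
      have h2 : t * (n * B) ≤ T * (n * B) := mul_le_mul_of_nonneg_right htT (by positivity)
      linarith
    have h1 := hC k (∫ s in (0 : ℝ)..t, g s).toNNReal
    rw [Real.coe_toNNReal _ hpos] at h1
    rw [intervalIntegral.integral_div, ← sub_div, abs_div, abs_of_pos hn0, div_le_iff₀ hn0,
      add_mul, div_mul_cancel₀ _ hn0.ne']
    have h2 := mul_le_mul_of_nonneg_left hle hδ0
    linarith
  have hRn : ∀ t, R t / n ≤ M.lam i := fun t => by
    rw [div_le_iff₀ hn0]; linarith [(hRmem t).2]
  set R' := fun t => (M.scale n).rateY ε α (x t) (y t) i with hR'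
  have hR'eq : R' = fun t => n * M.lam i - R t := by
    ext t; exact Model.rateY_scale n ε α _ _ i
  have hR'int : IntervalIntegrable R' volume 0 T := by
    rw [hR'eq]; exact intervalIntegrable_const.sub hRint
  have hR'mem : ∀ t, 0 ≤ R' t ∧ R' t ≤ n * M.lam i := fun t => by
    rw [hR'eq]; constructor <;> linarith [(hRmem t).1, (hRmem t).2]
  have hδT : δ * (M.lam i * T) ≤ M.lam i * T := mul_le_of_le_one_left (by positivity) hδ1
  have hCn1 : C / n ≤ 1 := (div_le_one hn0).2 hCn
  -- bounds on the arrivals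
  have harr : ∀ k (g : ℝ → ℝ), IntervalIntegrable g volume 0 T →
      (∀ t, 0 ≤ g t ∧ g t ≤ n * M.lam i) → ∀ t, 0 ≤ t → t ≤ T →
      (N k (∫ s in (0 : ℝ)..t, g s).toNNReal : ℝ) / n ≤ 2 * (M.lam i * T) + 1 := by
    intro k g hg hgm t ht htT
    have h1 := (abs_le.1 (hclock k g (M.lam i) hg (fun t _ _ => hgm t) hlam.le t ht htT)).2
    have h2 : ∫ s in (0 : ℝ)..t, g s / n ≤ ∫ s in (0 : ℝ)..t, M.lam i :=
      intervalIntegral.integral_mono_on ht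
        ((ApproxFlow.intervalIntegrable_of_le hg le_rfl ht htT).div_const _) (by simp)
        fun s _ => by rw [div_le_iff₀ hn0]; linarith [(hgm s).2]
    rw [intervalIntegral.integral_const, sub_zero, smul_eq_mul] at h2
    have h3 : t * M.lam i ≤ T * M.lam i := mul_le_mul_of_nonneg_right htT hlam.le
    linarith
  -- System 1 starts with at most ρ + 1, and arrivals contribute at most 2λT + 1. Departures only
  -- lower the count, so this bounds both occupancies before any departure clock is estimated.
  set L := M.rho i + 2 * (M.lam i * T) + 2 with hL
  have hy0' : |(y0 i : ℝ) / n - (1 - α i) * M.rho i| ≤ 1 / n := by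
    have h1 := (hy0 i).le
    rw [Model.scale_rho] at h1
    rw [le_div_iff₀ hn0, ← abs_of_pos hn0, ← abs_mul, abs_of_pos hn0, sub_mul,
      div_mul_cancel₀ _ hn0.ne']
    convert! h1 using 2
    ring
  have h1n : 1 / (n : ℝ) ≤ 1 := (div_le_one hn0).2 hn1
  have hex : ∀ t, 0 ≤ t → (x t i : ℝ) / n =
      (N (Clock.arrX, i) (∫ s in (0 : ℝ)..t, R s).toNNReal : ℝ) / n -
        (N (Clock.depX, i) (∫ s in (0 : ℝ)..t, M.mu i * (x s i : ℝ)).toNNReal : ℝ) / n :=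
    fun t ht => by
      rw [← sub_div]
      congr 1
      exact_mod_cast h.eq_x i t ht
  have hey : ∀ t, 0 ≤ t → (y t i : ℝ) / n = (y0 i : ℝ) / n +
      (N (Clock.arrY, i) (∫ s in (0 : ℝ)..t, R' s).toNNReal : ℝ) / n -
        (N (Clock.depY, i) (∫ s in (0 : ℝ)..t, M.mu i * (y s i : ℝ)).toNNReal : ℝ) / n :=
    fun t ht => by
      rw [← add_div, ← sub_div]
      congr 1
      exact_mod_cast h.eq_y i t ht
  have hxL : ∀ t, 0 ≤ t → t ≤ T → (x t i : ℝ) / n ≤ L := fun t ht htT => by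
    rw [hex t ht]
    have h1 := harr (Clock.arrX, i) R hRint hRmem t ht htT
    have h2 : 0 ≤ (N (Clock.depX, i)
      (∫ s in (0 : ℝ)..t, M.mu i * (x s i : ℝ)).toNNReal : ℝ) / n := by positivity
    linarith
  have hyL : ∀ t, 0 ≤ t → t ≤ T → (y t i : ℝ) / n ≤ L := fun t ht htT => by
    rw [hey t ht]
    have h1 := harr (Clock.arrY, i) R' hR'int hR'mem t ht htT
    have h2 : 0 ≤ (N (Clock.depY, i)
      (∫ s in (0 : ℝ)..t, M.mu i * (y s i : ℝ)).toNNReal : ℝ) / n := by positivity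
    have h3 := (abs_le.1 hy0').2
    have h4 : (1 - α i) * M.rho i ≤ M.rho i :=
      mul_le_of_le_one_left hρ.le (by linarith [(hα i).1])
    linarith
  have hL0 : 0 ≤ L := by positivity
  have hint : ∀ F : (Fin m → ℕ) → (Fin m → ℕ) → ℕ,
      (∀ t, 0 ≤ t → t ≤ T → (F (x t) (y t) : ℝ) / n ≤ L) →
      IntervalIntegrable (fun t => (F (x t) (y t) : ℝ)) volume 0 T := fun F hF =>
    intervalIntegrable_of_rightCont hT
      (fun t ht => h.continuousWithinAt_comp (fun a b => (F a b : ℝ)) ht) (L := L * n)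
      fun t ht htT => by
        rw [abs_of_nonneg (by positivity), ← div_le_iff₀ hn0]
        exact hF t ht htT
  have hxint := hint (fun a _ => a i) hxL
  have hyint := hint (fun _ b => b i) hyL
  have hdep : ∀ k (z : ℝ → ℕ), IntervalIntegrable (fun t => (z t : ℝ)) volume 0 T →
      (∀ t, 0 ≤ t → t ≤ T → (z t : ℝ) / n ≤ L) → ∀ t, 0 ≤ t → t ≤ T →
      |(N k (∫ s in (0 : ℝ)..t, M.mu i * (z s : ℝ)).toNNReal : ℝ) / n -
        ∫ s in (0 : ℝ)..t, M.mu i * ((z s : ℝ) / n)| ≤ δ * (M.mu i * L * T) + C / n := by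
    intro k z hz hzL t ht htT
    have := hclock k (fun s => M.mu i * (z s : ℝ)) (M.mu i * L) (hz.const_mul _)
      (fun s hs hsT => ⟨by positivity, by
        have h1 := hzL s hs hsT
        rw [div_le_iff₀ hn0] at h1
        have := mul_le_mul_of_nonneg_left h1 hmu.le
        linarith⟩) (by positivity) t ht htT
    simpa only [mul_div_assoc] using this
  have hx0 : (x 0 i : ℝ) / n = 0 := by
    rw [hex 0 le_rfl]; simp [h0]
  have hy00 : (y 0 i : ℝ) / n = (y0 i : ℝ) / n := by
    rw [hey 0 le_rfl]; simp [h0]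
  refine
    { int_nu := hRint.div_const _
      int_X := hxint.div_const _
      int_Y := hyint.div_const _
      nu_mem := fun t => ⟨div_nonneg (hRmem t).1 hn0.le, hRn t⟩
      X_nonneg := fun t => by positivity
      Y_nonneg := fun t => by positivity
      bounded := ⟨L, fun t ht htT => ⟨hxL t ht htT, hyL t ht htT⟩⟩
      X_zero := hx0
      Y_zero := ?_
      eq_X := fun t ht htT => ?_
      eq_Y := fun t ht htT => ?_ }
  · simp only [hy00]; exact hy0'.trans hη1
  · have h1 := abs_le.1 (hclock (Clock.arrX, i) R (M.lam i) hRint (fun t _ _ => hRmem t) hlam.le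
      t ht htT)
    have h2 := abs_le.1 (hdep (Clock.depX, i) (fun s => x s i) hxint hxL t ht htT)
    rw [intervalIntegral.integral_sub
      ((ApproxFlow.intervalIntegrable_of_le hRint le_rfl ht htT).div_const _)
      (((ApproxFlow.intervalIntegrable_of_le hxint le_rfl ht htT).div_const _).const_mul _)]
    rw [hex t ht, abs_le]
    constructor <;> linarith
  · have h1 := abs_le.1 (hclock (Clock.arrY, i) R' (M.lam i) hR'int (fun t _ _ => hR'mem t) hlam.le
      t ht htT)
    have h2 := abs_le.1 (hdep (Clock.depY, i) (fun s => y s i) hyint hyL t ht htT)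
    have h3 : ∫ s in (0 : ℝ)..t, R' s / n = ∫ s in (0 : ℝ)..t, (M.lam i - R s / n) := by
      refine intervalIntegral.integral_congr fun s _ => ?_
      simp only [hR'eq, sub_div, mul_div_cancel_left₀ _ hn0.ne']
    rw [intervalIntegral.integral_sub
      (intervalIntegrable_const.sub
        ((ApproxFlow.intervalIntegrable_of_le hRint le_rfl ht htT).div_const _))
      (((ApproxFlow.intervalIntegrable_of_le hyint le_rfl ht htT).div_const _).const_mul _), ← h3]
    rw [hy00, hey t ht, abs_le]
    constructor <;> linarith

end IsPenaltyPath

/-! ### Convergence to the fluid limit, and the loss of reward -/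

namespace Model

variable {m : ℕ} {M : Model m} {ε : ℝ} {α : Fin m → ℝ}

/-- If the clocks obey the law of large numbers, the scaled occupancies converge to the fluid
limit. -/
lemma Valid.tendsto_occupancy (hM : M.Valid) (hε : 0 < ε) (hε' : ε < 1 / 4)
    (hα : M.PrimalFeasible (M.perturbedCap ε) α) {N : Clock × Fin m → ℝ≥0 → ℕ}
    (h0 : ∀ k, N k 0 = 0) (hN : ∀ δ : ℝ, 0 < δ → ∃ C : ℝ, ∀ k t, |(N k t : ℝ) - t| ≤ δ * t + C)
    {y0 : ℕ → Fin m → ℕ}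
    (hy0 : ∀ n, 1 ≤ n → ∀ i, |(y0 n i : ℝ) - (1 - α i) * (M.scale n).rho i| < 1)
    {x y : ℕ → ℝ → Fin m → ℕ}
    (h : ∀ n, 1 ≤ n → IsPenaltyPath (M.scale n) ε α (y0 n) N (x n) (y n))
    {T : ℝ} (hT : 0 ≤ T) (i : Fin m) :
    Tendsto (fun n : ℕ => (x n T i : ℝ) / n) atTop (𝓝 (M.fluidOccupancy ε α i T)) := by
  obtain ⟨b', hb', hcap⟩ := hM.sum_size_mul_fluidOccupancy_lt hε hε' hα
  set A := ∑ j, M.size j with hA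
  have hA0 : 0 ≤ A := Finset.sum_nonneg fun j _ => (hM.size_pos j).le
  -- for every error level, all large systems are approximate flows
  have hflow : ∀ η : ℝ, 0 < η → ∃ n₀ : ℕ, ∀ n, n₀ ≤ n → 1 ≤ n ∧ 1 / (n : ℝ) ≤ η ∧ ∀ j,
      ApproxFlow (M.lam j) (M.mu j) (M.rho j) (α j) T η
        (fun t => (M.scale n).rateX ε α (x n t) (y n t) j / n)
        (fun t => (x n t j : ℝ) / n) (fun t => (y n t j : ℝ) / n) := by
    intro η hη
    set S := fun j => M.lam j * T + M.mu j * T * (M.rho j + 2 * (M.lam j * T) + 2) with hS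
    have hS0 : ∀ j, 0 ≤ S j := fun j => by
      have := hM.lam_pos j
      have := hM.mu_pos j
      have := hM.rho_pos j
      positivity
    have hSsum : 0 ≤ ∑ j, S j := Finset.sum_nonneg fun j _ => hS0 j
    -- Half of η is reserved for the clock deviations proportional to time, the other half for the
    -- constants C / n.
    set δ := min 1 (η / (2 * (∑ j, S j + 1))) with hδ
    have hδ0 : 0 < δ := lt_min one_pos (by positivity)
    obtain ⟨C, hC⟩ := hN δ hδ0
    obtain ⟨n₀, hn₀⟩ := exists_nat_ge (max 1 (max C (max (1 / η) (4 * C / η))))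
    refine ⟨n₀, fun n hn => ?_⟩
    have hnn : (n₀ : ℝ) ≤ n := by exact_mod_cast hn
    have hmax := hn₀.trans hnn
    simp only [max_le_iff] at hmax
    obtain ⟨h1, h2, h3, h4⟩ := hmax
    have hn1 : 1 ≤ n := by exact_mod_cast h1
    have hnpos : (0 : ℝ) < n := by linarith
    have hηn : 1 / (n : ℝ) ≤ η := by
      rw [div_le_iff₀ hη] at h3
      rw [div_le_iff₀ hnpos]
      linarith
    refine ⟨hn1, hηn, fun j => ?_⟩
    refine (h n hn1).approxFlow hM hn1 h0 hC hδ0.le (min_le_left _ _) h2 hα.2 (hy0 n hn1) hT j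
      ?_ hηn
    have h5 : δ * S j ≤ η / 2 := by
      have h6 : S j ≤ ∑ j, S j := Finset.single_le_sum (fun j _ => hS0 j) (Finset.mem_univ j)
      have h7 : δ * S j ≤ η / (2 * (∑ j, S j + 1)) * (∑ j, S j + 1) :=
        mul_le_mul (min_le_right _ _) (by linarith) (hS0 j) (by positivity)
      have h8 : η / (2 * (∑ j, S j + 1)) * (∑ j, S j + 1) = η / 2 := by
        field_simp
      linarith
    have h6 : 2 * (C / n) ≤ η / 2 := by
      rw [div_le_iff₀ hη] at h4
      have : C / n ≤ η / 4 := by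
        rw [div_le_iff₀ hnpos]
        linarith
      linarith
    simp only [hS] at h5
    linarith
  have hlr : ∀ j, M.lam j = M.mu j * M.rho j := fun j => by
    rw [rho, mul_div_cancel₀ _ (hM.mu_pos j).ne']
  -- the upper bound does not need the capacity constraint
  have hupper : ∀ (η : ℝ) (n : ℕ), 1 ≤ n → ∀ j,
      ApproxFlow (M.lam j) (M.mu j) (M.rho j) (α j) T η
        (fun t => (M.scale n).rateX ε α (x n t) (y n t) j / n)
        (fun t => (x n t j : ℝ) / n) (fun t => (y n t j : ℝ) / n) →
      ∀ t, 0 ≤ t → t ≤ T → (x n t j : ℝ) / n ≤ M.fluidOccupancy ε α j t + 13 * η := by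
    intro η n hn j hf t ht htT
    have hη := hf.eta_nonneg
    have h1 := hf.le_free (hM.mu_pos j) (hM.rho_pos j).le (hlr j) ht htT
    have h2 := hf.le_threshold (hM.mu_pos j) (hM.rho_pos j).le (hlr j) (hα.2 j).1 (hα.2 j).2
      (κ := M.thresholdShift ε α j) (fun s _ _ hs => by
        simp only [rateX, if_neg (hM.not_admits_scale hε hε' (hα.2 j) hn hs), zero_div]) ht htT
    have h3 := hM.relax_free_nonneg j ht
    rw [fluidOccupancy]
    rcases le_total (relax (M.mu j) (M.rho j) (M.rho j) t)
      (relax (M.mu j) (α j * M.rho j + M.thresholdShift ε α j) (α j ^ 2 * M.rho j) t) with hc | hc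
    · rw [min_eq_left hc, max_eq_right h3]
      linarith
    · rw [min_eq_right hc]
      exact h2
  rw [Metric.tendsto_atTop]
  intro e he
  -- Occupancies exceed the limit by at most 13η, and the size b_i / n of the arriving request is
  -- charged one further η.
  set η := min (e / 14) ((M.b - b') / (14 * (A + 1))) with hη
  have hη0 : 0 < η := lt_min (by positivity) (div_pos (by linarith) (by positivity))
  have hηe : 14 * η ≤ e := by
    have : η ≤ e / 14 := min_le_left _ _
    linarith
  have hηA : b' + 14 * η * A ≤ M.b := by
    have h1 : η ≤ (M.b - b') / (14 * (A + 1)) := min_le_right _ _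
    rw [le_div_iff₀ (by positivity)] at h1
    nlinarith
  obtain ⟨n₀, hn₀⟩ := hflow η hη0
  refine ⟨n₀, fun n hn => ?_⟩
  obtain ⟨hn1, hηn, hf⟩ := hn₀ n hn
  have hnpos : (0 : ℝ) < n := by exact_mod_cast hn1
  have hup := fun j => hupper η n hn1 j (hf j)
  -- The upper bounds of all classes together leave room for one more request throughout [0, T];
  -- admission of class i below its threshold is then unconditional.
  have hfits : ∀ t, 0 ≤ t → t ≤ T →
      ∑ j, M.size j * ((x n t j : ℝ) / n) + M.size i / n ≤ M.b := fun t ht htT => by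
    have h1 : ∑ j, M.size j * ((x n t j : ℝ) / n) ≤
        ∑ j, (M.size j * M.fluidOccupancy ε α j t + M.size j * (13 * η)) :=
      Finset.sum_le_sum fun j _ => by
        rw [← mul_add]
        exact mul_le_mul_of_nonneg_left (hup j t ht htT) (hM.size_pos j).le
    rw [Finset.sum_add_distrib, ← Finset.sum_mul] at h1
    have h2 := hcap t
    have h3 : M.size i ≤ A :=
      Finset.single_le_sum (fun j _ => (hM.size_pos j).le) (Finset.mem_univ i)
    have h4 : M.size i / n ≤ A * η := by
      rw [div_eq_mul_one_div]
      exact mul_le_mul h3 hηn (by positivity) hA0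
    linarith
  have hlow := (hf i).threshold_le (hM.mu_pos i) (hM.rho_pos i).le (hlr i) (hα.2 i).1 (hα.2 i).2
    (κ := M.thresholdShift ε α i) (fun s hs hsT hlt => by
      simp only [rateX, if_pos (hM.admits_scale hε hε' (hα.2 i) hn1 hlt (hfits s hs hsT))]
      exact mul_div_cancel_left₀ _ hnpos.ne') hT le_rfl
  have hlow' : M.fluidOccupancy ε α i T ≤ (x n T i : ℝ) / n + 13 * η :=
    max_le (by positivity) hlow
  have := hup i T hT le_rfl
  rw [Real.dist_eq, abs_lt]
  constructor <;> linarith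

/-- The fluid limit of the reward rate. -/
def fluidReward (M : Model m) (ε : ℝ) (α : Fin m → ℝ) (t : ℝ) : ℝ :=
  ∑ i, M.rew i * M.fluidOccupancy ε α i t

/-- The loss of reward rate per unit of `ε`. -/
def lossConstant (M : Model m) : ℝ :=
  ∑ i, M.rew i * M.rho i * (1 + 4 * M.b / M.weight i)

/-- The fluid reward rate is close to that of any `αs` near `α`. -/
lemma Valid.le_fluidReward (hM : M.Valid) (hε : 0 < ε) (hε' : ε < 1 / 4)
    (hα : M.PrimalFeasible (M.perturbedCap ε) α) {αs : Fin m → ℝ}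
    (hclose : ∀ i, M.weight i * |αs i - α i| ≤ M.b - M.perturbedCap ε) {t : ℝ} (ht : 0 ≤ t) :
    ∑ i, M.rew i * M.rho i * αs i * (1 - Real.exp (-(M.mu i * t))) - M.lossConstant * ε ≤
      M.fluidReward ε α t := by
  have hb : M.b - M.perturbedCap ε ≤ 4 * M.b * ε := by
    have h1 : 0 < 1 + 4 * ε := by linarith
    have h2 : M.b * (1 - 4 * ε) ≤ M.perturbedCap ε := by
      rw [perturbedCap, le_div_iff₀ h1]
      nlinarith [mul_nonneg hM.b_pos.le (sq_nonneg ε)]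
    linarith
  rw [lossConstant, fluidReward, Finset.sum_mul, ← Finset.sum_sub_distrib]
  refine Finset.sum_le_sum fun i _ => ?_
  have hw := hM.weight_pos i
  have hr := hM.rew_nonneg i
  have hv := hM.value_nonneg i
  have h1 : αs i ≤ α i + 4 * M.b / M.weight i * ε := by
    have h2 : |αs i - α i| ≤ 4 * M.b * ε / M.weight i := by
      rw [le_div_iff₀ hw]
      linarith [hclose i]
    have h3 := (le_abs_self _).trans h2
    have h4 : 4 * M.b * ε / M.weight i = 4 * M.b / M.weight i * ε := by ring
    linarith
  have hexp0 : 0 ≤ 1 - Real.exp (-(M.mu i * t)) := by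
    have : Real.exp (-(M.mu i * t)) ≤ 1 :=
      Real.exp_le_one_iff.2 (by linarith [mul_nonneg (hM.mu_pos i).le ht])
    linarith
  have hexp1 : 1 - Real.exp (-(M.mu i * t)) ≤ 1 := by linarith [Real.exp_pos (-(M.mu i * t))]
  have h5 := mul_le_mul_of_nonneg_left (hM.le_fluidOccupancy hε hε' (hα.2 i) ht) hr
  have h6 := mul_le_mul_of_nonneg_right (mul_le_mul_of_nonneg_left h1 hv) hexp0
  have h7 : M.rew i * M.rho i * (4 * M.b / M.weight i * ε) * (1 - Real.exp (-(M.mu i * t))) ≤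
      M.rew i * M.rho i * (4 * M.b / M.weight i * ε) := by
    have := hM.b_pos
    exact mul_le_of_le_one_right (by positivity) hexp1
  linarith

end Model

/-- Almost surely, all clocks start at zero and obey the law of large numbers. -/
lemma IsClockFamily.ae_lln {m : ℕ} {Ω : Type*} [MeasurableSpace Ω] {P : Measure Ω}
    [IsProbabilityMeasure P] {N : Clock × Fin m → ℝ≥0 → Ω → ℕ} (hN : IsClockFamily P N) :
    ∀ᵐ ω ∂P, (∀ k, N k 0 ω = 0) ∧
      ∀ δ : ℝ, 0 < δ → ∃ C : ℝ, ∀ k t, |(N k t ω : ℝ) - t| ≤ δ * t + C := by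
  have hfin : Finite (Clock × Fin m) := by
    have : Finite Clock := Finite.of_injective
      (fun c : Clock => match c with
        | .arrX => (0 : Fin 4) | .arrY => 1 | .depX => 2 | .depY => 3)
      (fun a b hab => by cases a <;> cases b <;> simp_all)
    infer_instance
  have hall : ∀ᵐ ω ∂P, ∀ k, N k 0 ω = 0 ∧ Monotone (fun t => N k t ω) ∧
      Tendsto (fun n : ℕ => (N k n ω : ℝ) / n) atTop (𝓝 1) := by
    rw [ae_all_iff]
    intro k
    filter_upwards [(hN.poisson k).zero, (hN.poisson k).paths, (hN.poisson k).tendsto_div]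
      with ω h1 h2 h3 using ⟨h1, h2.1, h3⟩
  filter_upwards [hall] with ω hω
  refine ⟨fun k => (hω k).1, fun δ hδ => ?_⟩
  choose C hC using fun k => exists_abs_sub_le_of_tendsto_div (hω k).2.1 (hω k).2.2 hδ
  obtain ⟨B, hB⟩ := (Set.finite_range C).bddAbove
  exact ⟨B, fun k t => (hC k t).trans (by linarith [hB ⟨k, rfl⟩])⟩

end LossNetwork

end

theorem theorem3 {m : ℕ} (M : LossNetwork.Model m) (hM : M.Valid) :
    ∃ C : ℝ, ∀ (u : ℝ) (v : Fin m → ℝ), M.DualOptimal M.b u v →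
      ∀ ε : ℝ, 0 < ε → ε < 1 / 4 → (ε : EReal) < M.epsZero u v →
      -- the limiting reward rate, for each optimal solution of the perturbed program
      ∃ Rlim : (Fin m → ℝ) → ℝ → ℝ,
        -- almost sure convergence to the nonrandom limit
        (∀ αε : Fin m → ℝ, M.PrimalOptimal (M.perturbedCap ε) αε →
          ∀ (Ω : Type*) [MeasurableSpace Ω] (P : Measure Ω) [IsProbabilityMeasure P]
            (N : LossNetwork.Clock × Fin m → ℝ≥0 → Ω → ℕ) (_ : LossNetwork.IsClockFamily P N)
            (y0 : ℕ → Fin m → ℕ)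
            (_ : ∀ n, 1 ≤ n → ∀ i, |(y0 n i : ℝ) - (1 - αε i) * (M.scale n).rho i| < 1)
            (x y : ℕ → ℝ → Ω → Fin m → ℕ)
            (_ : ∀ n, 1 ≤ n → ∀ᵐ ω ∂P, LossNetwork.IsPenaltyPath (M.scale n) ε αε (y0 n)
              (fun k s => N k s ω) (fun s => x n s ω) (fun s => y n s ω)),
            ∀ t : ℝ, 0 ≤ t → ∀ᵐ ω ∂P,
              Tendsto (fun n : ℕ => (M.scale n).rewardRate (x n t ω)) atTop (𝓝 (Rlim αε t))) ∧
        -- the lower bound, for given `αε` and a suitable `αs`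
        (∀ αε : Fin m → ℝ, M.PrimalOptimal (M.perturbedCap ε) αε →
          ∃ αs : Fin m → ℝ, M.PrimalOptimal M.b αs ∧ ∀ t : ℝ, 0 ≤ t →
            ∑ i, M.rew i * M.rho i * αs i * (1 - Real.exp (-(M.mu i * t))) - C * ε ≤
              Rlim αε t) ∧
        -- the lower bound, for given `αs` and a suitable `αε`
        (∀ αs : Fin m → ℝ, M.PrimalOptimal M.b αs →
          ∃ αε : Fin m → ℝ, M.PrimalOptimal (M.perturbedCap ε) αε ∧ ∀ t : ℝ, 0 ≤ t →
            ∑ i, M.rew i * M.rho i * αs i * (1 - Real.exp (-(M.mu i * t))) - C * ε ≤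
              Rlim αε t) := by
  refine ⟨M.lossConstant, fun u v _ ε hε hε' _ => ⟨M.fluidReward ε, ?_, ?_, ?_⟩⟩
  · intro αε hα Ω _ P _ N hN y0 hy0 x y hpath t ht
    -- Countably many systems are involved, so their exceptional null sets can be merged.
    have hall : ∀ᵐ ω ∂P, ∀ n, 1 ≤ n → LossNetwork.IsPenaltyPath (M.scale n) ε αε (y0 n)
        (fun k s => N k s ω) (fun s => x n s ω) (fun s => y n s ω) :=
      ae_all_iff.2 fun n => by
        by_cases hn : 1 ≤ n
        · filter_upwards [hpath n hn] with ω hω _ using hω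
        · exact Eventually.of_forall fun ω h => absurd h hn
    filter_upwards [hall, hN.ae_lln] with ω hω hlln
    have hlim := tendsto_finsetSum Finset.univ fun i _ =>
      (hM.tendsto_occupancy hε hε' hα.1 hlln.1 hlln.2 hy0 hω ht i).const_mul (M.rew i)
    refine hlim.congr fun n => Finset.sum_congr rfl fun i _ => ?_
    simp only [LossNetwork.Model.scale]
    ring
  all_goals
    have hB : 0 < M.perturbedCap ε := div_pos hM.b_pos (by linarith)
    have hBb : M.perturbedCap ε ≤ M.b := div_le_self hM.b_pos.le (by linarith)
  · intro αε hα
    obtain ⟨αs, hαs, hclose⟩ := hM.exists_primalOptimal_of_le hBb hα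
    exact ⟨αs, hαs, fun t ht => hM.le_fluidReward hε hε' hα.1 hclose ht⟩
  · intro αs hαs
    obtain ⟨αε, hα, hclose⟩ := hM.exists_primalOptimal_of_ge hB.le hBb hM.b_pos hαs
    exact ⟨αε, hα, fun t ht => hM.le_fluidReward hε hε' hα.1 hclose ht⟩
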